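/- Let $(\Omega,\mathcal F,(\mathcal F_t)_{t\ge 0},\mathbb P)$ be a filtered probability space satisfying the usual conditions. A point process on a set $I$ is a random measure on $I$ with values in $\{0,1,2,\dots\}\cup\{+\infty\}$ that is finite on bounded sets; a point process $N$ on $\mathbb R$ is adapted if $N|_{(-\infty,t]}$ is $\mathcal F_t$-measurable for every $t\ge 0$. Let $Q$ be an $(\mathcal F_t)$-Poisson point process on $(0,+\infty)\times(0,+\infty)$ with unit intensity, i.e. a point process such that for all $t,s,a>0$ the variable $Q((t,t+s]\times(0,a])$ is $\mathcal F_{t+s}$-measurable, independent of $\mathcal F_t$, and Poisson of parameter $sa$. Let $\lambda>0$, let $h:(0,+\infty)\to\mathbb R$ be measurable, with positive part $h^+=\max(h,0)$, and let $N^0$ be an $\mathcal F_0$-measurable point process on $(-\infty,0]$. Assume that $$\|h^+\|_1=\int_0^{\infty}h^+(t)\,dt<1 \quad\text{and}\quad \forall t>0,\ \int_0^t\mathbb E\Big(\int_{(-\infty,0]}h^+(u-s)\,N^0(ds)\Big)du<+\infty .$$ For a measurable $g:(0,+\infty)\to\mathbb R$ consider the equation, for an adapted point process $N^g$ on $\mathbb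 R$, $$N^g=N^0+\int_{(0,+\infty)\times(0,+\infty)}\delta_u\,\mathbf 1_{\{\theta\le\Lambda^g(u)\}}\,Q(du,d\theta),\qquad \Lambda^g(u)=\Big(\lambda+\int_{(-\infty,u)}g(u-s)\,N^g(ds)\Big)^+,\quad u>0, \tag{E$_g$}$$ to hold almost surely. Here $\Lambda^g(u)\in[0,+\infty]$ is the positive part of $\lambda+\int_{(-\infty,u)} g^+(u-s)\,N^g(ds)-\int_{(-\infty,u)} g^-(u-s)\,N^g(ds)$, which is read as $0$ when both integrals are infinite. A solution is strong if for every $t\ge 0$ its restriction to $(-\infty,t]$ is measurable with respect to the $\mathbb P$-completion of the $\sigma$-field generated by $N^0$ and $Q|_{(0,t]\times(0,+\infty)}$; it is pathwise unique if every solution with the same $N^0$ and $Q$ is almost surely equal to it. An adapted point process $N$ on $\mathbb R$ is a Hawkes process on $(0,+\infty)$ with initial condition $N^0$, immigration rate $\lambda$ and reproduction measure $g(t)\,dt$ if $N|_{(-\infty,0]}=N^0$ a.s. and the conditional intensity measure of $N|_{(0,+\infty)}$ with respect to $(\mathcal F_t)$ is $\Lambda(u)\,du$, where $\Lambda(u)=\big(\lambda+\int_{(-\infty,u)}g(u-s)\,N(ds)\big)^+$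 with the same convention as above; that is, $\Lambda$ is predictable, $\int_0^t\Lambda(u)\,du<\infty$ for all $t$ a.s., and $\mathbb E\int_{(0,\infty)}C_u\,N(du)=\mathbb E\int_0^\infty C_u\,\Lambda(u)\,du$ for every nonnegative predictable process $C$. Then: a) (E$_h$) has a pathwise unique strong solution $N^h$, and $N^h$ is a Hawkes process on $(0,+\infty)$ with initial condition $N^0$, immigration rate $\lambda$ and reproduction measure $h(t)\,dt$. b) The same holds for $h^+$: (E$_{h^+}$) has a pathwise unique strong solution $N^{h^+}$, and $N^{h^+}$ is a Hawkes process on $(0,+\infty)$ with initial condition $N^0$, immigration rate $\lambda$ and reproduction measure $h^+(t)\,dt$. Moreover, for these solutions, driven by the same $Q$, $N^h\le N^{h^+}$ almost surely, in the sense of measures. -/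

import Mathlib

open MeasureTheory ProbabilityTheory Set
open scoped ENNReal NNReal

namespace SignedHawkes

/-- Boundedly finite counting measures: Borel measures with values in `{0, 1, 2, …} ∪ {∞}` which
are finite on bounded sets. -/
structure IsCountingMeasure {α : Type*} [PseudoMetricSpace α] [MeasurableSpace α]
    (ν : Measure α) : Prop where
  finite_of_isBounded : ∀ B : Set α, Bornology.IsBounded B → ν B < ∞
  integer_valued : ∀ B : Set α, MeasurableSet B → ∃ n : ℕ∞, ν B = n

/-- The usual conditions: the filtration is right-continuous and `𝓕 0` contains all the
`P`-null sets (`P` denotes the outer measure here, so the space is complete). -/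
structure UsualConditions {Ω : Type*} {mΩ : MeasurableSpace Ω} (𝓕 : Filtration ℝ≥0 mΩ)
    (P : Measure Ω) : Prop where
  rightContinuous : 𝓕.IsRightContinuous
  null_mem : ∀ A : Set Ω, P A = 0 → MeasurableSet[𝓕 0] A

/-- `Q` is an `𝓕`-Poisson point process on `(0,∞) × (0,∞)` with unit intensity: a random
boundedly finite counting measure on the open quadrant such that, for all `t, s, a > 0`, the
variable `Q((t,t+s] × (0,a])` is `𝓕 (t+s)`-measurable, independent of `𝓕 t`, and Poisson of
parameter `s a`. -/
structure IsPoissonPointProcess {Ω : Type*} {mΩ : MeasurableSpace Ω} (𝓕 : Filtration ℝ≥0 mΩ)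
    (P : Measure Ω) (Q : Ω → Measure (ℝ × ℝ)) : Prop where
  measurable : Measurable Q
  counting : ∀ ω, IsCountingMeasure (Q ω)
  quadrant : ∀ ω, Q ω (Ioi 0 ×ˢ Ioi 0)ᶜ = 0
  adapted : ∀ t s a : ℝ≥0, 0 < t → 0 < s → 0 < a →
    Measurable[𝓕 (t + s)] fun ω ↦ Q ω (Ioc (t : ℝ) (t + s) ×ˢ Ioc (0 : ℝ) a)
  indep : ∀ t s a : ℝ≥0, 0 < t → 0 < s → 0 < a →
    Indep (MeasurableSpace.comap (fun ω ↦ Q ω (Ioc (t : ℝ) (t + s) ×ˢ Ioc (0 : ℝ) a))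
      inferInstance) (𝓕 t) P
  law : ∀ t s a : ℝ≥0, 0 < t → 0 < s → 0 < a →
    HasLaw (fun ω ↦ Q ω (Ioc (t : ℝ) (t + s) ×ˢ Ioc (0 : ℝ) a))
      ((poissonMeasure (s * a)).map (Nat.cast : ℕ → ℝ≥0∞)) P

/-- `N0` is an initial condition: an `𝓕 0`-measurable boundedly finite point process on
`(-∞,0]`. -/
structure IsInitialCondition {Ω : Type*} {mΩ : MeasurableSpace Ω} (𝓕 : Filtration ℝ≥0 mΩ)
    (N0 : Ω → Measure ℝ) : Prop where
  measurable : Measurable[𝓕 0] N0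
  counting : ∀ ω, IsCountingMeasure (N0 ω)
  support : ∀ ω, N0 ω (Ioi 0) = 0

/-- `N` is an adapted boundedly finite point process on `ℝ`: for all `t ≥ 0` its restriction to
`(-∞,t]` is `𝓕 t`-measurable. -/
structure IsAdaptedPointProcess {Ω : Type*} {mΩ : MeasurableSpace Ω} (𝓕 : Filtration ℝ≥0 mΩ)
    (N : Ω → Measure ℝ) : Prop where
  counting : ∀ ω, IsCountingMeasure (N ω)
  adapted : ∀ t : ℝ≥0, Measurable[𝓕 t] fun ω ↦ (N ω).restrict (Iic (t : ℝ))

/-- The intensity `Λ(u) = (lam + ∫_{(-∞,u)} h(u-s) ν(ds))⁺`, with values in `[0,∞]`. The integrals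
of the positive and of the negative part of `h` are taken separately, in `[0,∞]`, and the
truncated subtraction `a - b` of `[0,∞]` is the positive part of the difference. In particular
`Λ(u) = 0` if only the integral of the negative part is infinite. -/
noncomputable def intensity (lam : ℝ) (h : ℝ → ℝ) (ν : Measure ℝ) (u : ℝ) : ℝ≥0∞ :=
  (ENNReal.ofReal lam + ∫⁻ s in Iio u, ENNReal.ofReal (h (u - s)) ∂ν)
    - ∫⁻ s in Iio u, ENNReal.ofReal (-h (u - s)) ∂ν

/-- The point process `∫ δ_u 1_{θ ≤ Λ(u)} q(du,dθ)` on `(0,∞)`, the integral being over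
`(0,∞) × (0,∞)`: the image by `(u,θ) ↦ u` of the part of `q` lying below the graph of `Λ`. -/
noncomputable def thinning (q : Measure (ℝ × ℝ)) (Λ : ℝ → ℝ≥0∞) : Measure ℝ :=
  (q.restrict {p | 0 < p.1 ∧ 0 < p.2 ∧ ENNReal.ofReal p.2 ≤ Λ p.1}).map Prod.fst

/-- `N` is a solution of the equation `N = N0 + ∫ δ_u 1_{θ ≤ Λ(u)} Q(du,dθ)`, where `Λ` is the
intensity associated with `N` itself: an adapted boundedly finite point process satisfying the
equation almost surely. -/
structure IsSolution {Ω : Type*} {mΩ : MeasurableSpace Ω} (𝓕 : Filtration ℝ≥0 mΩ)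
    (P : Measure Ω) (lam : ℝ) (h : ℝ → ℝ) (N0 : Ω → Measure ℝ) (Q : Ω → Measure (ℝ × ℝ))
    (N : Ω → Measure ℝ) : Prop where
  adapted : IsAdaptedPointProcess 𝓕 N
  equation : ∀ᵐ ω ∂P, N ω = N0 ω + thinning (Q ω) (intensity lam h (N ω))

/-- The σ-field generated by `N0` and by the restriction of `Q` to `(0,t] × (0,∞)`. -/
@[reducible] noncomputable def drivingSigma {Ω : Type*} (N0 : Ω → Measure ℝ) (Q : Ω → Measure (ℝ × ℝ))
    (t : ℝ≥0) : MeasurableSpace Ω :=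
  MeasurableSpace.comap
    (fun ω ↦ (N0 ω, (Q ω).restrict (Ioc (0 : ℝ) t ×ˢ univ))) inferInstance

/-- A solution is strong if it is adapted to the completed filtration generated by the data: for
every `t ≥ 0`, the restriction of `N` to `(-∞,t]` is almost surely equal to a random measure that
is measurable for the σ-field generated by `N0` and by `Q` on `(0,t] × (0,∞)`. -/
structure IsStrongSolution {Ω : Type*} {mΩ : MeasurableSpace Ω} (𝓕 : Filtration ℝ≥0 mΩ)
    (P : Measure Ω) (lam : ℝ) (h : ℝ → ℝ) (N0 : Ω → Measure ℝ) (Q : Ω → Measure (ℝ × ℝ))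
    (N : Ω → Measure ℝ) : Prop where
  solution : IsSolution 𝓕 P lam h N0 Q N
  strong : ∀ t : ℝ≥0, ∃ M : Ω → Measure ℝ, Measurable[drivingSigma N0 Q t] M ∧
    ∀ᵐ ω ∂P, (N ω).restrict (Iic (t : ℝ)) = M ω

/-- `N` is the pathwise unique strong solution: it is a strong solution, and every solution
driven by the same data on the same filtered space is almost surely equal to it. -/
structure IsPathwiseUniqueStrongSolution {Ω : Type*} {mΩ : MeasurableSpace Ω}
    (𝓕 : Filtration ℝ≥0 mΩ) (P : Measure Ω) (lam : ℝ) (h : ℝ → ℝ) (N0 : Ω → Measure ℝ)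
    (Q : Ω → Measure (ℝ × ℝ)) (N : Ω → Measure ℝ) : Prop where
  strongSolution : IsStrongSolution 𝓕 P lam h N0 Q N
  unique : ∀ N' : Ω → Measure ℝ, IsSolution 𝓕 P lam h N0 Q N' → ∀ᵐ ω ∂P, N' ω = N ω

/-- The conditional intensity measure (the predictable compensator) of `N` restricted to `(0,∞)`,
with respect to `𝓕`, is `Λ(u) du`: the process `Λ` is predictable and locally integrable, and
`E ∫_{(0,∞)} C(u) N(du) = E ∫_{(0,∞)} C(u) Λ(u) du` for all nonnegative predictable `C`. -/
structure HasConditionalIntensity {Ω : Type*} {mΩ : MeasurableSpace Ω} (𝓕 : Filtration ℝ≥0 mΩ)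
    (P : Measure Ω) (N : Ω → Measure ℝ) (Λ : Ω → ℝ → ℝ≥0∞) : Prop where
  predictable : Measurable[𝓕.predictable] fun p : ℝ≥0 × Ω ↦ Λ p.2 (p.1 : ℝ)
  locallyIntegrable : ∀ᵐ ω ∂P, ∀ t : ℝ, ∫⁻ u in Ioc 0 t, Λ ω u < ∞
  compensation : ∀ C : ℝ≥0 × Ω → ℝ≥0∞, Measurable[𝓕.predictable] C →
    ∫⁻ ω, (∫⁻ u in Ioi (0 : ℝ), C (u.toNNReal, ω) ∂(N ω)) ∂P
      = ∫⁻ ω, (∫⁻ u in Ioi (0 : ℝ), C (u.toNNReal, ω) * Λ ω u ∂volume) ∂P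

/-- `N` is a Hawkes process on `(0,∞)` with initial condition `N0`, immigration rate `lam` and
reproduction measure `h(t) dt`. -/
structure IsHawkesProcess {Ω : Type*} {mΩ : MeasurableSpace Ω} (𝓕 : Filtration ℝ≥0 mΩ)
    (P : Measure Ω) (lam : ℝ) (h : ℝ → ℝ) (N0 : Ω → Measure ℝ) (N : Ω → Measure ℝ) : Prop where
  adapted : IsAdaptedPointProcess 𝓕 N
  initial : ∀ᵐ ω ∂P, (N ω).restrict (Iic 0) = N0 ω
  conditionalIntensity : HasConditionalIntensity 𝓕 P N fun ω ↦ intensity lam h (N ω)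

end SignedHawkes

/-!
The equation is solved path by path, and probability enters at two points only.

Solutions are constructed by Picard iteration (`picard`), where the intensity is truncated at level
`n` in the `n`-th step, so that every iterate is boundedly finite. For `h⁺` the iterates increase,
and they dominate the iterates for `h` (`picard_le_picard_max`), because dropping the negative part
of `h` and adding points both increase the intensity. If the iterates for `h⁺` have bounded masses
on `(0, t]`, they are eventually constant there, as monotone integers are
(`stabilizes_picard_max`). The iterates for `h` then live on finitely many possible atoms; going
from one atom to the next, the past before the atom is eventually constant, hence so is the
intensity, and the decision whether the atom is kept depends monotonically on the truncation level
only (`stabilizes_picard`). The limits solve the equations (`IsLimit.equation`). The same induction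
over atoms (`gap_induction`), applied to the sum of two solutions, gives uniqueness
(`eq_of_equation`); no moment is needed there since solutions are boundedly finite by definition.

The first probabilistic input is the compensation formula `IsPoissonPointProcess.lintegral_eq`: in
expectation, `Q` may be replaced by Lebesgue measure when the integrand is predictable. By a
π-λ argument it reduces to a single rectangle over an event of its past. It yields the conditional
intensity of a thinning, and also the recursion `x (n + 1) ≤ c + ‖h⁺‖₁ * x n` for the expected
numbers of points of the iterates in `(0, t]` (`exists_lintegral_picard_le`). As `‖h⁺‖₁ < 1`, these
are bounded, and so the iterates for `h⁺` almost surely have bounded masses.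

The second is measurability. The strict past of an adapted random measure is predictable
(`measurable_restrict_Iio_predictable`), therefore so is the intensity, and the thinning by a
predictable process is adapted. This applies to any filtration to which the data are adapted
(`IsDriven`): with the given filtration one obtains adapted solutions, with the filtration generated
by the data one obtains that they are strong.
-/

namespace SignedHawkes

open Filter Topology

/-! ### Boundedly finite counting measures -/

lemma eq_zero_of_integer_of_lt_one {x : ℝ≥0∞} (hx : ∃ n : ℕ∞, x = n) (h : x < 1) : x = 0 := by
  obtain ⟨n, rfl⟩ := hx
  have : n < 1 := by exact_mod_cast h
  simpa using this

lemma IsCountingMeasure.isLocallyFiniteMeasure {ν : Measure ℝ} (hν : IsCountingMeasure ν) :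
    IsLocallyFiniteMeasure ν :=
  ⟨fun x ↦ ⟨Metric.ball x 1, Metric.ball_mem_nhds x one_pos,
    hν.finite_of_isBounded _ Metric.isBounded_ball⟩⟩

lemma IsCountingMeasure.sFinite {ν : Measure ℝ} (hν : IsCountingMeasure ν) : SFinite ν := by
  have := hν.isLocallyFiniteMeasure
  infer_instance

lemma IsCountingMeasure.add {α : Type*} [PseudoMetricSpace α] [MeasurableSpace α]
    {μ ν : Measure α} (hμ : IsCountingMeasure μ) (hν : IsCountingMeasure ν) :
    IsCountingMeasure (μ + ν) where
  finite_of_isBounded B hB := by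
    simpa using ⟨hμ.finite_of_isBounded B hB, hν.finite_of_isBounded B hB⟩
  integer_valued B hB := by
    obtain ⟨m, hm⟩ := hμ.integer_valued B hB
    obtain ⟨n, hn⟩ := hν.integer_valued B hB
    exact ⟨m + n, by simp [hm, hn]⟩

lemma restrict_Iic_eq_add (μ : Measure ℝ) {a b : ℝ} (hab : a ≤ b) :
    μ.restrict (Iic b) = μ.restrict (Iic a) + μ.restrict (Ioc a b) := by
  rw [← Iic_union_Ioc_eq_Iic hab, Measure.restrict_union _ measurableSet_Ioc]
  exact Set.disjoint_left.2 fun x hx hx' ↦ not_lt.2 hx hx'.1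

lemma restrict_Iio_eq_add (μ : Measure ℝ) {a b : ℝ} (hab : a < b) :
    μ.restrict (Iio b) = μ.restrict (Iic a) + μ.restrict (Ioo a b) := by
  rw [← Iic_union_Ioo_eq_Iio hab, Measure.restrict_union _ measurableSet_Ioo]
  exact Set.disjoint_left.2 fun x hx hx' ↦ not_lt.2 hx hx'.1

lemma restrict_eq_of_restrict_eq {α : Type*} [MeasurableSpace α] {μ ν : Measure α} {s t : Set α}
    (h : μ.restrict t = ν.restrict t) (hst : s ⊆ t) : μ.restrict s = ν.restrict s := by
  rw [← Measure.restrict_restrict_of_subset hst, h, Measure.restrict_restrict_of_subset hst]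

lemma ext_of_restrict_Iic {μ ν : Measure ℝ}
    (h : ∀ t : ℝ≥0, μ.restrict (Iic (t : ℝ)) = ν.restrict (Iic (t : ℝ))) : μ = ν := by
  refine Measure.ext_of_iUnion_eq_univ (s := fun n : ℕ ↦ Iic (n : ℝ)) ?_ fun n ↦ by simpa using h n
  exact iUnion_eq_univ_iff.2 fun x ↦ exists_nat_ge x

/-- An integer valued measure which is finite on `(T, t]` does not charge some interval `(T, s)`. -/
lemma exists_right_gap {M : Measure ℝ} {T t : ℝ} (hTt : T < t) (hfin : M (Ioc T t) < ∞)
    (hint : ∀ B, MeasurableSet B → ∃ n : ℕ∞, M B = n) :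
    ∃ s, T < s ∧ s ≤ t ∧ M (Ioo T s) = 0 := by
  have hlim : Tendsto (fun n : ℕ ↦ M (Ioo T (T + (t - T) / (n + 1)))) atTop (𝓝 0) := by
    have hanti : Antitone fun n : ℕ ↦ Ioo T (T + (t - T) / (n + 1)) := by
      intro m n hmn
      apply Ioo_subset_Ioo_right
      have : (m : ℝ) ≤ n := by exact_mod_cast hmn
      have : 0 ≤ t - T := by linarith
      gcongr
    have hne : (⋂ n : ℕ, Ioo T (T + (t - T) / (n + 1))) = ∅ := by
      ext x
      simp only [mem_iInter, mem_Ioo, mem_empty_iff_false, iff_false, not_forall]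
      by_cases hx : T < x
      · obtain ⟨n, hn⟩ := exists_nat_gt ((t - T) / (x - T))
        refine ⟨n, fun h ↦ ?_⟩
        rw [div_lt_iff₀ (by linarith)] at hn
        have h2 := h.2
        have : x - T < (t - T) / (n + 1) := by linarith
        rw [lt_div_iff₀ (by positivity)] at this
        nlinarith
      · exact ⟨0, fun h ↦ hx h.1⟩
    have := tendsto_measure_iInter_atTop (μ := M)
      (s := fun n : ℕ ↦ Ioo T (T + (t - T) / (n + 1)))
      (fun n ↦ measurableSet_Ioo.nullMeasurableSet) hanti
      ⟨0, ((measure_mono (by intro x; simp; intro h1 h2; exact ⟨h1, h2.le⟩)).trans_lt hfin).ne⟩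
    rwa [hne, measure_empty] at this
  obtain ⟨n, hn⟩ := (hlim.eventually_lt_const (u := 1) (by simp)).exists
  refine ⟨_, ?_, ?_, eq_zero_of_integer_of_lt_one (hint _ measurableSet_Ioo) hn⟩
  · have : 0 < (t - T) / (n + 1) := by apply div_pos <;> [linarith; positivity]
    linarith
  · have : (t - T) / (n + 1) ≤ t - T := div_le_self (by linarith) (by simp)
    linarith

/-- An integer valued measure which is finite on `(r, T)` does not charge some interval
`(s, T)`. -/
lemma exists_left_gap {M : Measure ℝ} {r T : ℝ} (hrT : r < T) (hfin : M (Ioo r T) < ∞)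
    (hint : ∀ B, MeasurableSet B → ∃ n : ℕ∞, M B = n) :
    ∃ s, r ≤ s ∧ s < T ∧ M (Ioo s T) = 0 := by
  have hlim : Tendsto (fun n : ℕ ↦ M (Ioo (T - (T - r) / (n + 1)) T)) atTop (𝓝 0) := by
    have hanti : Antitone fun n : ℕ ↦ Ioo (T - (T - r) / (n + 1)) T := by
      intro m n hmn
      apply Ioo_subset_Ioo_left
      have : (m : ℝ) ≤ n := by exact_mod_cast hmn
      have : 0 ≤ T - r := by linarith
      gcongr
    have hne : (⋂ n : ℕ, Ioo (T - (T - r) / (n + 1)) T) = ∅ := by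
      ext x
      simp only [mem_iInter, mem_Ioo, mem_empty_iff_false, iff_false, not_forall]
      by_cases hx : x < T
      · obtain ⟨n, hn⟩ := exists_nat_gt ((T - r) / (T - x))
        refine ⟨n, fun h ↦ ?_⟩
        rw [div_lt_iff₀ (by linarith)] at hn
        have h2 := h.1
        have : T - x < (T - r) / (n + 1) := by linarith
        rw [lt_div_iff₀ (by positivity)] at this
        nlinarith
      · exact ⟨0, fun h ↦ hx h.2⟩
    have := tendsto_measure_iInter_atTop (μ := M)
      (s := fun n : ℕ ↦ Ioo (T - (T - r) / (n + 1)) T)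
      (fun n ↦ measurableSet_Ioo.nullMeasurableSet) hanti ⟨0, by simpa using hfin.ne⟩
    rwa [hne, measure_empty] at this
  obtain ⟨n, hn⟩ := (hlim.eventually_lt_const (u := 1) (by simp)).exists
  refine ⟨_, ?_, ?_, eq_zero_of_integer_of_lt_one (hint _ measurableSet_Ioo) hn⟩
  · have : (T - r) / (n + 1) ≤ T - r := div_le_self (by linarith) (by simp)
    linarith
  · have : 0 < (T - r) / (n + 1) := by apply div_pos <;> [linarith; positivity]
    linarith

/-- Induction along the atoms of an integer valued measure `M` which is finite on `(0, t]`: a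
property which holds at `0` and which propagates from `r` to `s` as soon as `M` does not charge
`(r, s)` holds at `t`. -/
lemma gap_induction {M : Measure ℝ} {t : ℝ} (ht : 0 ≤ t) (hfin : M (Ioc 0 t) < ∞)
    (hint : ∀ B, MeasurableSet B → ∃ n : ℕ∞, M B = n) {p : ℝ → Prop} (h0 : p 0)
    (hstep : ∀ r s, 0 ≤ r → r < s → s ≤ t → p r → M (Ioo r s) = 0 → p s) : p t := by
  set S : Set ℝ := {s | 0 ≤ s ∧ s ≤ t ∧ p s} with hS
  have hne : S.Nonempty := ⟨0, le_rfl, ht, h0⟩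
  have hbdd : BddAbove S := ⟨t, fun s hs ↦ hs.2.1⟩
  set T := sSup S with hT
  have hT0 : 0 ≤ T := le_csSup hbdd ⟨le_rfl, ht, h0⟩
  have hTt : T ≤ t := csSup_le hne fun s hs ↦ hs.2.1
  have hpT : p T := by
    by_contra hpT
    have hT0' : 0 < T := lt_of_le_of_ne hT0 fun h ↦ hpT (h ▸ h0)
    obtain ⟨s, hs0, hsT, hs⟩ := exists_left_gap hT0'
      ((measure_mono fun x (hx : x ∈ Ioo 0 T) ↦
        (⟨hx.1, hx.2.le.trans hTt⟩ : x ∈ Ioc 0 t)).trans_lt hfin) hint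
    obtain ⟨r, hr, hsr⟩ := exists_lt_of_lt_csSup hne hsT
    have hrT : r < T := lt_of_le_of_ne (le_csSup hbdd hr) fun h ↦ hpT (h ▸ hr.2.2)
    exact hpT (hstep r T hr.1 hrT hTt hr.2.2
      (measure_mono_null (Ioo_subset_Ioo_left hsr.le) hs))
  rcases hTt.eq_or_lt with h | h
  · rwa [← h]
  · obtain ⟨s, hTs, hst, hs⟩ := exists_right_gap h
      ((measure_mono (Ioc_subset_Ioc_left hT0)).trans_lt hfin) hint
    exact absurd (le_csSup hbdd ⟨hT0.trans hTs.le, hst, hstep T s hT0 hTs hst hpT hs⟩)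
      (not_le.2 hTs)

/-! ### The intensity and the thinning as functions of the past -/

lemma measurable_intensity {lam : ℝ} {h : ℝ → ℝ} (hh : Measurable h) {ν : Measure ℝ} [SFinite ν] :
    Measurable (intensity lam h ν) := by
  have key : ∀ g : ℝ → ℝ, Measurable g →
      Measurable fun u ↦ ∫⁻ s in Iio u, ENNReal.ofReal (g (u - s)) ∂ν := by
    intro g hg
    simp_rw [← lintegral_indicator measurableSet_Iio]
    refine Measurable.lintegral_prod_right'
      (f := fun p : ℝ × ℝ ↦ (Iio p.1).indicator (fun s ↦ ENNReal.ofReal (g (p.1 - s))) p.2) ?_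
    exact Measurable.indicator (s := {p : ℝ × ℝ | p.2 < p.1}) (by fun_prop)
      (measurableSet_lt measurable_snd measurable_fst)
  exact (measurable_const.add (key h hh)).sub (key (fun t ↦ -h t) hh.neg)

lemma intensity_congr {lam : ℝ} {h : ℝ → ℝ} {μ ν : Measure ℝ} {s u : ℝ}
    (hμν : μ.restrict (Iio s) = ν.restrict (Iio s)) (hus : u ≤ s) :
    intensity lam h μ u = intensity lam h ν u := by
  simp only [intensity, restrict_eq_of_restrict_eq hμν (Iio_subset_Iio hus)]

/-- The comparison at the heart of the coupling: dropping the negative part of `h` and adding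
points can only increase the intensity. -/
lemma intensity_le_intensity_max {lam : ℝ} {h : ℝ → ℝ} {μ ν : Measure ℝ} (hμν : μ ≤ ν) (u : ℝ) :
    intensity lam h μ u ≤ intensity lam (fun t ↦ max (h t) 0) ν u := by
  simp only [intensity]
  have h1 : ∀ x : ℝ, ENNReal.ofReal (-max x 0) = 0 := fun x ↦ by simp
  have h2 : ∀ x : ℝ, ENNReal.ofReal (max x 0) = ENNReal.ofReal x := fun x ↦ by simp
  simp only [h1, h2, lintegral_zero, tsub_zero]
  refine tsub_le_self.trans ?_
  gcongr

/-- The part of the open quadrant that lies below the graph of `Λ`. -/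
def region (Λ : ℝ → ℝ≥0∞) : Set (ℝ × ℝ) :=
  {p | 0 < p.1 ∧ 0 < p.2 ∧ ENNReal.ofReal p.2 ≤ Λ p.1}

lemma measurableSet_region {Λ : ℝ → ℝ≥0∞} (hΛ : Measurable Λ) : MeasurableSet (region Λ) :=
  (measurableSet_lt measurable_const measurable_fst).inter
    ((measurableSet_lt measurable_const measurable_snd).inter
      (measurableSet_le (ENNReal.measurable_ofReal.comp measurable_snd) (hΛ.comp measurable_fst)))

lemma thinning_apply (q : Measure (ℝ × ℝ)) (Λ : ℝ → ℝ≥0∞) {B : Set ℝ} (hB : MeasurableSet B) :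
    thinning q Λ B = q (Prod.fst ⁻¹' B ∩ region Λ) := by
  rw [thinning, Measure.map_apply measurable_fst hB, Measure.restrict_apply (measurable_fst hB)]
  rfl

lemma thinning_Iic_zero (q : Measure (ℝ × ℝ)) (Λ : ℝ → ℝ≥0∞) : thinning q Λ (Iic 0) = 0 := by
  rw [thinning_apply _ _ measurableSet_Iic]
  convert measure_empty (μ := q)
  ext p
  simp only [region, mem_inter_iff, mem_preimage, mem_Iic, mem_ofPred_eq, mem_empty_iff_false,
    iff_false]
  exact fun h ↦ not_lt.2 h.1 h.2.1

lemma thinning_mono (q : Measure (ℝ × ℝ)) {Λ Λ' : ℝ → ℝ≥0∞} (h : ∀ u, Λ u ≤ Λ' u) :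
    thinning q Λ ≤ thinning q Λ' :=
  Measure.map_mono (Measure.restrict_mono_set q fun _ hp ↦ ⟨hp.1, hp.2.1, hp.2.2.trans (h _)⟩)
    measurable_fst

lemma thinning_restrict_mono (q : Measure (ℝ × ℝ)) {Λ Λ' : ℝ → ℝ≥0∞} {t : ℝ}
    (h : ∀ u ≤ t, Λ u ≤ Λ' u) :
    (thinning q Λ).restrict (Iic t) ≤ (thinning q Λ').restrict (Iic t) := by
  refine Measure.le_iff.2 fun B hB ↦ ?_
  rw [Measure.restrict_apply hB, Measure.restrict_apply hB,
    thinning_apply _ _ (hB.inter measurableSet_Iic),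
    thinning_apply _ _ (hB.inter measurableSet_Iic)]
  exact measure_mono fun p hp ↦ ⟨hp.1, hp.2.1, hp.2.2.1, hp.2.2.2.trans (h _ hp.1.2)⟩

lemma thinning_restrict_congr (q : Measure (ℝ × ℝ)) {Λ Λ' : ℝ → ℝ≥0∞} {t : ℝ}
    (h : ∀ u ≤ t, Λ u = Λ' u) :
    (thinning q Λ).restrict (Iic t) = (thinning q Λ').restrict (Iic t) :=
  le_antisymm (thinning_restrict_mono q fun u hu ↦ (h u hu).le)
    (thinning_restrict_mono q fun u hu ↦ (h u hu).ge)

lemma thinning_restrict_Iic_zero (q : Measure (ℝ × ℝ)) (Λ : ℝ → ℝ≥0∞) :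
    (thinning q Λ).restrict (Iic 0) = 0 :=
  Measure.restrict_eq_zero.2 (thinning_Iic_zero q Λ)

lemma isCountingMeasure_thinning {q : Measure (ℝ × ℝ)} (hq : IsCountingMeasure q)
    {Λ : ℝ → ℝ≥0∞} (hΛ : Measurable Λ) (C : ℕ) (hC : ∀ u, Λ u ≤ C) :
    IsCountingMeasure (thinning q Λ) where
  finite_of_isBounded B hB := by
    obtain ⟨r, hr⟩ := hB.subset_closedBall 0
    refine (measure_mono hr).trans_lt ?_
    rw [thinning_apply _ _ Metric.isClosed_closedBall.measurableSet]
    refine (measure_mono ?_).trans_lt (hq.finite_of_isBounded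
      (Metric.closedBall 0 r ×ˢ Icc (0 : ℝ) C) (Metric.isBounded_closedBall.prod
        (Metric.isBounded_Icc _ _)))
    intro p hp
    refine ⟨hp.1, hp.2.2.1.le, ?_⟩
    have := hp.2.2.2.trans (hC _)
    simpa using (ENNReal.ofReal_le_natCast (n := C)).1 this
  integer_valued B hB := by
    rw [thinning_apply _ _ hB]
    exact hq.integer_valued _ ((measurable_fst hB).inter (measurableSet_region hΛ))

/-- Two boundedly finite solutions with the same data coincide: if they agree up to time `r`,
they have the same intensity up to the first atom of their sum after `r`, hence they agree up to
and including that atom. -/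
lemma eq_of_equation {lam : ℝ} {h : ℝ → ℝ} {n₀ : Measure ℝ} {q : Measure (ℝ × ℝ)}
    {μ ν : Measure ℝ} (hμ : IsCountingMeasure μ) (hν : IsCountingMeasure ν)
    (hμe : μ = n₀ + thinning q (intensity lam h μ))
    (hνe : ν = n₀ + thinning q (intensity lam h ν)) : μ = ν := by
  refine ext_of_restrict_Iic fun t ↦ ?_
  have hM := hμ.add hν
  refine gap_induction (M := μ + ν) (p := fun s ↦ μ.restrict (Iic s) = ν.restrict (Iic s))
    t.2 (hM.finite_of_isBounded _ (Metric.isBounded_Ioc _ _)) hM.integer_valued ?_ ?_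
  · rw [hμe, hνe, Measure.restrict_add, Measure.restrict_add, thinning_restrict_Iic_zero,
      thinning_restrict_Iic_zero]
  · intro r s _ hrs _ hr hgap
    simp only [Measure.add_apply, add_eq_zero] at hgap
    have hlt : μ.restrict (Iio s) = ν.restrict (Iio s) := by
      rw [restrict_Iio_eq_add _ hrs, restrict_Iio_eq_add _ hrs, hr,
        Measure.restrict_eq_zero.2 hgap.1, Measure.restrict_eq_zero.2 hgap.2]
    rw [hμe, hνe, Measure.restrict_add, Measure.restrict_add,
      thinning_restrict_congr q fun u hu ↦ intensity_congr hlt hu]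

/-! ### The truncated Picard iteration -/

/-- Picard iteration started from the initial condition. In the `n`-th step the intensity is
truncated at level `n`, so that each iterate is boundedly finite without exception. -/
noncomputable def picard (lam : ℝ) (h : ℝ → ℝ) (n₀ : Measure ℝ) (q : Measure (ℝ × ℝ)) :
    ℕ → Measure ℝ
  | 0 => n₀
  | n + 1 => n₀ + thinning q fun u ↦ min (intensity lam h (picard lam h n₀ q n) u) n

variable {lam : ℝ} {h : ℝ → ℝ} {n₀ : Measure ℝ} {q : Measure (ℝ × ℝ)}

lemma isCountingMeasure_picard (hh : Measurable h) (hn₀ : IsCountingMeasure n₀)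
    (hq : IsCountingMeasure q) (n : ℕ) : IsCountingMeasure (picard lam h n₀ q n) := by
  induction n with
  | zero => exact hn₀
  | succ n ih =>
    have := ih.sFinite
    exact hn₀.add (isCountingMeasure_thinning hq ((measurable_intensity hh).min measurable_const)
      n fun u ↦ min_le_right _ _)

lemma picard_le_picard_max (n : ℕ) :
    picard lam h n₀ q n ≤ picard lam (fun t ↦ max (h t) 0) n₀ q n := by
  induction n with
  | zero => exact le_rfl
  | succ n ih =>
    exact add_le_add le_rfl (thinning_mono q fun u ↦
      min_le_min_right _ (intensity_le_intensity_max ih u))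

lemma picard_max_mono : Monotone (picard lam (fun t ↦ max (h t) 0) n₀ q) := by
  refine monotone_nat_of_le_succ fun n ↦ ?_
  induction n with
  | zero => exact Measure.le_add_right le_rfl
  | succ n ih =>
    refine add_le_add le_rfl (thinning_mono q fun u ↦ min_le_min ?_ (by simp))
    simpa using intensity_le_intensity_max (lam := lam) (h := fun t ↦ max (h t) 0) ih u

lemma picard_restrict_Iic_zero (n : ℕ) :
    (picard lam h n₀ q n).restrict (Iic 0) = n₀.restrict (Iic 0) := by
  cases n with
  | zero => rfl
  | succ n => rw [picard, Measure.restrict_add, thinning_restrict_Iic_zero, add_zero]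

/-- A bounded sequence of integers which is nondecreasing from some index on is eventually
constant. -/
lemma eventually_const_of_integer {x : ℕ → ℝ≥0∞} (hx : ∀ n, ∃ k : ℕ∞, x n = k) {m : ℕ} {C : ℝ≥0∞}
    (hC : C < ∞) (hbd : ∀ n ≥ m, x n ≤ C) (hmono : ∀ n ≥ m, x n ≤ x (n + 1)) :
    ∃ n₁ ≥ m, ∀ n ≥ n₁, x n = x n₁ := by
  have hk : ∀ n : ℕ, ∃ k : ℕ, x (m + n) = k := by
    intro n
    obtain ⟨k, hk⟩ := hx (m + n)
    have : k ≠ ⊤ := by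
      rintro rfl
      have := (hbd (m + n) (by omega)).trans_lt hC
      simp [hk] at this
    lift k to ℕ using this
    exact ⟨k, by simpa using hk⟩
  choose k hk using hk
  have hkm : Monotone k := monotone_nat_of_le_succ fun n ↦ by
    have := hmono (m + n) (by omega)
    rw [hk, add_assoc, hk] at this
    exact_mod_cast this
  have hbdd : BddAbove (range k) := by
    obtain ⟨K, hK⟩ := ENNReal.exists_nat_gt hC.ne
    refine ⟨K, ?_⟩
    rintro _ ⟨n, rfl⟩
    have := (hbd (m + n) (by omega)).trans hK.le
    rw [hk] at this
    exact_mod_cast this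
  obtain ⟨n₁, hn₁⟩ := Nat.sSup_mem (range_nonempty k) hbdd
  refine ⟨m + n₁, by omega, fun n hn ↦ ?_⟩
  obtain ⟨j, rfl⟩ := Nat.exists_eq_add_of_le hn
  rw [add_assoc, hk, hk]
  congr 1
  refine le_antisymm ?_ (hkm (by omega))
  rw [hn₁]
  exact le_csSup hbdd ⟨_, rfl⟩

/-- The sequence `ν` of measures is eventually constant on `(-∞, t]`. -/
def Stabilizes (ν : ℕ → Measure ℝ) (t : ℝ) : Prop :=
  ∃ n₁, ∀ n ≥ n₁, (ν n).restrict (Iic t) = (ν n₁).restrict (Iic t)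

/-- Monotonicity from some index on, together with a bound for the masses, forces a sequence of
boundedly finite counting measures to be eventually constant. -/
lemma stabilizes_of_mono {ν : ℕ → Measure ℝ} (hν : ∀ n, IsCountingMeasure (ν n)) {t : ℝ}
    (ht : 0 ≤ t) (h0 : ∀ n, (ν n).restrict (Iic 0) = (ν 0).restrict (Iic 0)) {m : ℕ} {C : ℝ≥0∞}
    (hC : C < ∞) (hbd : ∀ n ≥ m, ν n (Ioc 0 t) ≤ C)
    (hmono : ∀ n ≥ m, (ν n).restrict (Iic t) ≤ (ν (n + 1)).restrict (Iic t)) :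
    Stabilizes ν t := by
  have hmono' : ∀ n ≥ m, (ν n).restrict (Ioc 0 t) ≤ (ν (n + 1)).restrict (Ioc 0 t) := by
    intro n hn
    have := Measure.restrict_mono (subset_refl (Ioc 0 t)) (hmono n hn)
    rwa [Measure.restrict_restrict_of_subset Ioc_subset_Iic_self,
      Measure.restrict_restrict_of_subset Ioc_subset_Iic_self] at this
  obtain ⟨n₁, hn₁m, hn₁⟩ := eventually_const_of_integer (x := fun n ↦ ν n (Ioc 0 t))
    (fun n ↦ (hν n).integer_valued _ measurableSet_Ioc) hC hbd
    (fun n hn ↦ by simpa using hmono' n hn univ)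
  refine ⟨n₁, fun n hn ↦ ?_⟩
  rw [restrict_Iic_eq_add _ ht, restrict_Iic_eq_add _ ht, h0 n, h0 n₁]
  congr 1
  have hle : (ν n₁).restrict (Ioc 0 t) ≤ (ν n).restrict (Ioc 0 t) := by
    induction n, hn using Nat.le_induction with
    | base => exact le_rfl
    | succ k hk ih => exact ih.trans (hmono' k (hn₁m.trans hk))
  have : IsFiniteMeasure ((ν n₁).restrict (Ioc 0 t)) :=
    ⟨by simpa using (hν n₁).finite_of_isBounded _ (Metric.isBounded_Ioc _ _)⟩
  exact (Measure.eq_of_le_of_measure_univ_eq hle (by simpa using (hn₁ n hn).symm)).symm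

lemma stabilizes_picard_max (hh : Measurable h) (hn₀ : IsCountingMeasure n₀)
    (hq : IsCountingMeasure q) {t : ℝ} (ht : 0 ≤ t)
    (hfin : ⨆ n, picard lam (fun t ↦ max (h t) 0) n₀ q n (Ioc 0 t) < ∞) :
    Stabilizes (picard lam (fun t ↦ max (h t) 0) n₀ q) t :=
  stabilizes_of_mono (m := 0) (isCountingMeasure_picard (hh.max measurable_const) hn₀ hq) ht
    (fun n ↦ picard_restrict_Iic_zero n) hfin (fun n _ ↦ le_iSup_iff.2 fun _ hb ↦ hb n)
    fun n _ ↦ Measure.restrict_mono subset_rfl (picard_max_mono (Nat.le_succ n))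

/-- If the iterates for `h⁺` have bounded masses on `(0, t]`, then those for `h` are eventually
constant on `(-∞, t]`. All of them are carried by the atoms of the limit for `h⁺`; between two
such atoms nothing happens, and once the iterates agree strictly before an atom, only the
truncation level matters at the atom, where they are therefore nondecreasing. -/
lemma stabilizes_picard (hh : Measurable h) (hn₀ : IsCountingMeasure n₀)
    (hq : IsCountingMeasure q) {t : ℝ} (ht : 0 ≤ t)
    (hfin : ⨆ n, picard lam (fun t ↦ max (h t) 0) n₀ q n (Ioc 0 t) < ∞) :
    Stabilizes (picard lam h n₀ q) t := by
  obtain ⟨n₁, hn₁⟩ := stabilizes_picard_max (lam := lam) hh hn₀ hq ht hfin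
  set M := picard lam (fun t ↦ max (h t) 0) n₀ q n₁ with hMdef
  have hM : IsCountingMeasure M := isCountingMeasure_picard (hh.max measurable_const) hn₀ hq n₁
  have hMt : M (Ioc 0 t) < ∞ := hM.finite_of_isBounded _ (Metric.isBounded_Ioc _ _)
  have hle : ∀ n B, MeasurableSet B → B ⊆ Iic t → picard lam h n₀ q n B ≤ M B := by
    intro n B hB hBt
    refine (picard_le_picard_max n B).trans ((picard_max_mono (le_max_left n n₁) B).trans ?_)
    have := congrArg (fun μ : Measure ℝ ↦ μ B) (hn₁ (max n n₁) (le_max_right _ _))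
    simpa [Measure.restrict_apply hB, inter_eq_left.2 hBt] using this.le
  refine gap_induction (M := M) (p := Stabilizes (picard lam h n₀ q)) ht hMt hM.integer_valued
    ⟨0, fun n _ ↦ picard_restrict_Iic_zero n⟩ ?_
  rintro r s hr hrs hst ⟨m, hm⟩ hgap
  have hlt : ∀ n ≥ m, (picard lam h n₀ q n).restrict (Iio s)
      = (picard lam h n₀ q m).restrict (Iio s) := by
    intro n hn
    have h0 : ∀ k, (picard lam h n₀ q k).restrict (Ioo r s) = 0 := fun k ↦
      Measure.restrict_eq_zero.2 (le_antisymm ((hle k _ measurableSet_Ioo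
        fun x hx ↦ hx.2.le.trans hst).trans hgap.le) zero_le)
    rw [restrict_Iio_eq_add _ hrs, restrict_Iio_eq_add _ hrs, hm n hn, h0, h0]
  refine stabilizes_of_mono (m := m + 1) (isCountingMeasure_picard hh hn₀ hq) (hr.trans hrs.le)
    (fun n ↦ picard_restrict_Iic_zero n) hMt (fun n _ ↦ ?_) fun n hn ↦ ?_
  · exact (hle n _ measurableSet_Ioc (fun x hx ↦ hx.2.trans hst)).trans
      (measure_mono (Ioc_subset_Ioc_right hst))
  · obtain ⟨k, rfl⟩ : ∃ k, n = k + 1 := ⟨n - 1, by omega⟩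
    rw [picard, picard, Measure.restrict_add, Measure.restrict_add]
    refine add_le_add le_rfl
      (thinning_restrict_mono q fun u hu ↦ min_le_min (le_of_eq ?_) (by simp))
    exact (intensity_congr (hlt k (by omega)) hu).trans
      (intensity_congr (hlt (k + 1) (by omega)) hu).symm

/-! ### The limit of the Picard iteration -/

lemma measure_eq_iSup_inter_Iic (μ : Measure ℝ) (B : Set ℝ) :
    μ B = ⨆ i : ℕ, μ (B ∩ Iic (i : ℝ)) := by
  have hmono : Monotone fun i : ℕ ↦ B ∩ Iic (i : ℝ) := fun i j hij ↦
    inter_subset_inter_right _ (Iic_subset_Iic.2 (by exact_mod_cast hij))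
  have hU : ⋃ i : ℕ, Iic (i : ℝ) = univ := iUnion_eq_univ_iff.2 fun x ↦ exists_nat_ge x
  rw [← hmono.measure_iUnion, ← inter_iUnion, hU, inter_univ]

lemma le_of_restrict_Iic {μ ν : Measure ℝ}
    (h : ∀ t : ℝ≥0, μ.restrict (Iic (t : ℝ)) ≤ ν.restrict (Iic (t : ℝ))) : μ ≤ ν := by
  refine Measure.le_iff.2 fun B hB ↦ ?_
  rw [measure_eq_iSup_inter_Iic, measure_eq_iSup_inter_Iic ν]
  refine iSup_mono fun i ↦ ?_
  have := h i B
  simpa [Measure.restrict_apply hB] using this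

/-- `μ` is the limit of `ν`: on each half line `(-∞, t]`, the sequence is eventually equal
to `μ`. -/
def IsLimit (ν : ℕ → Measure ℝ) (μ : Measure ℝ) : Prop :=
  ∀ t : ℝ≥0, ∀ᶠ n in atTop, (ν n).restrict (Iic (t : ℝ)) = μ.restrict (Iic (t : ℝ))

lemma exists_isLimit {ν : ℕ → Measure ℝ} (hs : ∀ t : ℝ≥0, Stabilizes ν t) :
    ∃ μ, IsLimit ν μ := by
  choose k hk using fun i : ℕ ↦ hs i
  set A : ℕ → Set ℝ := disjointed fun i : ℕ ↦ Iic (i : ℝ) with hA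
  have hAm : ∀ i, MeasurableSet (A i) := fun i ↦
    MeasurableSet.disjointed (fun i ↦ measurableSet_Iic) i
  have hAd : Pairwise (Function.onFun Disjoint A) := disjoint_disjointed _
  have hAU : ⋃ i, A i = univ := by
    rw [hA, iUnion_disjointed, iUnion_eq_univ_iff]
    exact fun x ↦ exists_nat_ge x
  have hAi : ∀ i, A i ⊆ Iic (i : ℝ) := fun i ↦ disjointed_subset _ i
  have hAj : ∀ i j : ℕ, j < i → A i ∩ Iic (j : ℝ) = ∅ := by
    intro i j hji
    ext x
    simp only [mem_inter_iff, mem_Iic, mem_empty_iff_false, iff_false, not_and, not_le]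
    intro hx
    by_contra hxj
    rw [not_lt] at hxj
    rw [hA, disjointed_eq_inter_compl] at hx
    have := hx.2
    simp only [mem_iInter] at this
    exact this j hji hxj
  refine ⟨Measure.sum fun i ↦ (ν (k i)).restrict (A i), fun t ↦ ?_⟩
  obtain ⟨j, hj⟩ := exists_nat_ge (t : ℝ)
  have hev : ∀ᶠ n in atTop, ∀ i ∈ Finset.range (j + 1), k i ≤ n :=
    (Filter.eventually_all_finset _).2 fun i _ ↦ eventually_ge_atTop (k i)
  filter_upwards [hev] with n hn
  refine restrict_eq_of_restrict_eq (t := Iic (j : ℝ)) ?_ (Iic_subset_Iic.2 hj)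
  ext B hB
  rw [Measure.restrict_apply hB, Measure.restrict_apply hB,
    Measure.sum_apply _ (hB.inter measurableSet_Iic)]
  have : ν n = Measure.sum fun i ↦ (ν n).restrict (A i) := by
    rw [← Measure.restrict_iUnion hAd hAm, hAU, Measure.restrict_univ]
  rw [this, Measure.sum_apply _ (hB.inter measurableSet_Iic)]
  refine tsum_congr fun i ↦ ?_
  rw [Measure.restrict_apply (hB.inter measurableSet_Iic),
    Measure.restrict_apply (hB.inter measurableSet_Iic)]
  rcases lt_or_ge j i with hij | hij
  · rw [inter_assoc, inter_comm (Iic (j : ℝ)), hAj i j hij]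
    simp
  · have := congrArg (fun μ : Measure ℝ ↦ μ (B ∩ Iic (j : ℝ) ∩ A i))
      (hk i n (hn i (Finset.mem_range.2 (by omega))))
    simpa [Measure.restrict_eq_self _ (inter_subset_right.trans (hAi i))] using this

lemma IsLimit.isCountingMeasure {ν : ℕ → Measure ℝ} {μ : Measure ℝ} (h : IsLimit ν μ)
    (hν : ∀ n, IsCountingMeasure (ν n)) : IsCountingMeasure μ := by
  have key : ∀ t : ℝ≥0, ∃ n, ∀ B ⊆ Iic (t : ℝ), μ B = ν n B := by
    intro t
    obtain ⟨n, hn⟩ := (h t).exists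
    refine ⟨n, fun B hB ↦ ?_⟩
    rw [← Measure.restrict_eq_self μ hB, ← hn, Measure.restrict_eq_self _ hB]
  constructor
  · intro B hB
    obtain ⟨r, hr⟩ := hB.subset_closedBall 0
    obtain ⟨n, hn⟩ := key r.toNNReal
    rw [hn B]
    · exact (hν n).finite_of_isBounded B hB
    · intro x hx
      have := hr hx
      rw [Real.closedBall_eq_Icc] at this
      exact (this.2.trans (by simp)).trans (Real.le_coe_toNNReal r)
  · intro B hB
    have : ∀ i : ℕ, ∃ k : ℕ∞, μ (B ∩ Iic (i : ℝ)) = k := by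
      intro i
      obtain ⟨n, hn⟩ := key i
      rw [hn _ (by simp)]
      exact (hν n).integer_valued _ (hB.inter measurableSet_Iic)
    choose k hk using this
    exact ⟨⨆ i, k i, by rw [measure_eq_iSup_inter_Iic]; simp [hk]⟩

lemma IsLimit.mono {ν ν' : ℕ → Measure ℝ} {μ μ' : Measure ℝ} (h : IsLimit ν μ)
    (h' : IsLimit ν' μ') (hle : ∀ n, ν n ≤ ν' n) : μ ≤ μ' := by
  refine le_of_restrict_Iic fun t ↦ ?_
  obtain ⟨n, hn, hn'⟩ := ((h t).and (h' t)).exists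
  rw [← hn, ← hn']
  exact Measure.restrict_mono subset_rfl (hle n)

lemma IsLimit.le_iSup {ν : ℕ → Measure ℝ} {μ : Measure ℝ} (h : IsLimit ν μ) (t : ℝ≥0) :
    μ (Ioc 0 (t : ℝ)) ≤ ⨆ n, ν n (Ioc 0 (t : ℝ)) := by
  obtain ⟨n, hn⟩ := (h t).exists
  rw [← Measure.restrict_eq_self μ (Ioc_subset_Iic_self : Ioc 0 (t : ℝ) ⊆ Iic (t : ℝ)), ← hn,
    Measure.restrict_eq_self _ Ioc_subset_Iic_self]
  exact _root_.le_iSup (fun n ↦ ν n (Ioc 0 (t : ℝ))) n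

lemma tendsto_thinning_min (q : Measure (ℝ × ℝ)) (Λ : ℝ → ℝ≥0∞) {B : Set ℝ}
    (hB : MeasurableSet B) :
    Tendsto (fun n : ℕ ↦ thinning q (fun u ↦ min (Λ u) n) B) atTop (𝓝 (thinning q Λ B)) := by
  simp_rw [thinning_apply _ _ hB]
  have hmono : Monotone fun n : ℕ ↦ Prod.fst ⁻¹' B ∩ region fun u ↦ min (Λ u) n := by
    intro m n hmn p hp
    exact ⟨hp.1, hp.2.1, hp.2.2.1, hp.2.2.2.trans (min_le_min le_rfl (by exact_mod_cast hmn))⟩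
  have hU : ⋃ n : ℕ, (Prod.fst ⁻¹' B ∩ region fun u ↦ min (Λ u) n)
      = Prod.fst ⁻¹' B ∩ region Λ := by
    ext p
    rw [mem_iUnion]
    constructor
    · rintro ⟨n, hp⟩
      exact ⟨hp.1, hp.2.1, hp.2.2.1, hp.2.2.2.trans (min_le_left _ _)⟩
    · intro hp
      obtain ⟨n, hn⟩ := exists_nat_ge p.2
      exact ⟨n, hp.1, hp.2.1, hp.2.2.1, le_min hp.2.2.2 (ENNReal.ofReal_le_natCast.2 hn)⟩
  rw [← hU]
  exact tendsto_measure_iUnion_atTop hmono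

/-- The limit of the Picard iteration solves the equation. -/
lemma IsLimit.equation {lam : ℝ} {h : ℝ → ℝ} {n₀ : Measure ℝ} {q : Measure (ℝ × ℝ)}
    {μ : Measure ℝ} (hμ : IsLimit (picard lam h n₀ q) μ) :
    μ = n₀ + thinning q (intensity lam h μ) := by
  refine ext_of_restrict_Iic fun t ↦ ?_
  ext B hB
  rw [Measure.restrict_apply hB, Measure.restrict_apply hB]
  have hC := hB.inter (measurableSet_Iic (a := (t : ℝ)))
  set C := B ∩ Iic (t : ℝ) with hCdef
  have hCt : C ⊆ Iic (t : ℝ) := inter_subset_right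
  have hlim : Tendsto (fun n : ℕ ↦ n₀ C + thinning q (fun u ↦ min (intensity lam h μ u) n) C)
      atTop (𝓝 (n₀ C + thinning q (intensity lam h μ) C)) :=
    tendsto_const_nhds.add (tendsto_thinning_min q _ hC)
  refine tendsto_nhds_unique (tendsto_const_nhds.congr' ?_) hlim
  filter_upwards [hμ t, (tendsto_add_atTop_nat 1).eventually (hμ t)] with n hn hn1
  have hcongr : (thinning q fun u ↦ min (intensity lam h (picard lam h n₀ q n) u) n).restrict
        (Iic (t : ℝ))
      = (thinning q fun u ↦ min (intensity lam h μ u) n).restrict (Iic (t : ℝ)) :=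
    thinning_restrict_congr q fun u hu ↦ by
      rw [intensity_congr (restrict_eq_of_restrict_eq hn Iio_subset_Iic_self) hu]
  rw [← Measure.restrict_eq_self μ hCt, ← hn1, picard, Measure.restrict_add, Measure.add_apply,
    hcongr, Measure.restrict_eq_self _ hCt, Measure.restrict_eq_self _ hCt]

/-! ### Measurable families of locally finite measures -/

section Families

variable {α E : Type*} [MeasurableSpace α] [MeasurableSpace E]

/-- A measurable family of finite measures is an s-finite kernel, although the masses need not be
uniformly bounded: split it according to the integer part of the mass. -/
lemma isSFiniteKernel_of_isFiniteMeasure (κ : Kernel α E) (hκ : ∀ a, IsFiniteMeasure (κ a)) :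
    IsSFiniteKernel κ := by
  have hs : ∀ n : ℕ, MeasurableSet {a | ⌊(κ a univ).toReal⌋₊ = n} := fun n ↦
    (Nat.measurable_floor.comp (κ.measurable_coe .univ).ennreal_toReal) (measurableSet_singleton n)
  classical
  refine ⟨fun n ↦ Kernel.piecewise (hs n) κ 0, fun n ↦ ⟨⟨n + 1, by finiteness, fun a ↦ ?_⟩⟩, ?_⟩
  · rw [Kernel.piecewise_apply]
    split_ifs with ha
    · have hlt := Nat.lt_floor_add_one (κ a univ).toReal
      rw [show ⌊(κ a univ).toReal⌋₊ = n from ha] at hlt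
      rw [← ENNReal.ofReal_toReal (measure_ne_top (κ a) univ)]
      refine (ENNReal.ofReal_le_ofReal hlt.le).trans (le_of_eq ?_)
      rw [ENNReal.ofReal_add (by positivity) zero_le_one]
      simp
    · simp
  · ext a B hB
    rw [Kernel.sum_apply' _ _ hB, tsum_eq_single ⌊(κ a univ).toReal⌋₊]
    · rw [Kernel.piecewise_apply]
      simp
    · intro n hn
      rw [Kernel.piecewise_apply, if_neg (fun h ↦ hn (by simpa using h.symm))]
      simp

/-- The kernel attached to a measurable family of measures that are finite on bounded sets is
s-finite. -/
lemma isSFiniteKernel_of_finite_of_isBounded [PseudoMetricSpace E] [OpensMeasurableSpace E]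
    [Nonempty E] (κ : Kernel α E) (hκ : ∀ a, ∀ B, Bornology.IsBounded B → κ a B < ∞) :
    IsSFiniteKernel κ := by
  obtain ⟨x⟩ := ‹Nonempty E›
  set A : ℕ → Set E := disjointed fun n : ℕ ↦ Metric.ball x n
  have hA : ∀ n, MeasurableSet (A n) := fun n ↦
    MeasurableSet.disjointed (fun n ↦ measurableSet_ball) n
  have hAU : ⋃ n, A n = univ := by rw [iUnion_disjointed, Metric.iUnion_ball_nat]
  have hsum : κ = Kernel.sum fun n ↦ κ.restrict (hA n) := by
    ext a : 1
    rw [Kernel.sum_apply]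
    simp only [Kernel.restrict_apply]
    rw [← Measure.restrict_iUnion (disjoint_disjointed _) hA, hAU, Measure.restrict_univ]
  rw [hsum]
  have : ∀ n, IsSFiniteKernel (κ.restrict (hA n)) := fun n ↦ by
    refine isSFiniteKernel_of_isFiniteMeasure _ fun a ↦ ⟨?_⟩
    rw [Kernel.restrict_apply, Measure.restrict_apply_univ]
    exact (measure_mono (disjointed_subset _ n)).trans_lt (hκ a _ Metric.isBounded_ball)
  infer_instance

variable [PseudoMetricSpace E] [OpensMeasurableSpace E] [Nonempty E]

lemma measurable_measure_section {κ : α → Measure E} (hκ : Measurable κ)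
    (hfin : ∀ a, ∀ B, Bornology.IsBounded B → κ a B < ∞) {S : Set (α × E)} (hS : MeasurableSet S) :
    Measurable fun a ↦ κ a {e | (a, e) ∈ S} := by
  have := isSFiniteKernel_of_finite_of_isBounded ⟨κ, hκ⟩ hfin
  exact Kernel.measurable_kernel_prodMk_left (κ := ⟨κ, hκ⟩) hS

lemma measurable_lintegral_section {κ : α → Measure E} (hκ : Measurable κ)
    (hfin : ∀ a, ∀ B, Bornology.IsBounded B → κ a B < ∞) {f : α × E → ℝ≥0∞} (hf : Measurable f) :
    Measurable fun a ↦ ∫⁻ e, f (a, e) ∂(κ a) := by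
  have := isSFiniteKernel_of_finite_of_isBounded ⟨κ, hκ⟩ hfin
  exact Measurable.lintegral_kernel_prod_right' (κ := ⟨κ, hκ⟩) hf

end Families

/-- The pointwise eventual value of a sequence of measurable measure valued maps is measurable. -/
lemma exists_measurable_eventually_eq {α : Type*} [MeasurableSpace α] {ν : ℕ → α → Measure ℝ}
    (hν : ∀ n, Measurable (ν n)) {A : Set α} (hA : MeasurableSet A)
    (hlim : ∀ a ∈ A, ∃ μ, ∀ᶠ n in atTop, ν n a = μ) :
    ∃ M : α → Measure ℝ, Measurable M ∧ ∀ a ∈ A, ∀ᶠ n in atTop, ν n a = M a := by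
  classical
  choose! M hM using hlim
  refine ⟨A.indicator M, Measure.measurable_of_measurable_coe _ fun B hB ↦ ?_, fun a ha ↦ ?_⟩
  · have : (fun a ↦ (A.indicator M a) B)
        = A.indicator fun a ↦ limsup (fun n ↦ ν n a B) atTop := by
      ext a
      by_cases ha : a ∈ A
      · simp only [indicator_of_mem ha]
        have : (fun n ↦ ν n a B) =ᶠ[atTop] fun _ ↦ M a B := by
          filter_upwards [hM a ha] with n hn using by rw [hn]
        rw [limsup_congr this, limsup_const]
      · simp [indicator_of_notMem ha]
    rw [this]
    exact (Measurable.limsup fun n ↦ (Measure.measurable_coe hB).comp (hν n)).indicator hA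
  · simpa only [indicator_of_mem ha] using hM a ha

/-! ### Predictability of the intensity -/

section Predictable

variable {Ω : Type*} {mΩ : MeasurableSpace Ω} {𝓗 : Filtration ℝ≥0 mΩ}

lemma predictable_le_prod (𝓗 : Filtration ℝ≥0 mΩ) :
    𝓗.predictable ≤ (inferInstance : MeasurableSpace (ℝ≥0 × Ω)) :=
  measurableSpace_le_predictable_of_measurableSet
    (fun A hA ↦ (measurableSet_singleton _).prod (𝓗.le _ A hA))
    (fun _ A hA ↦ measurableSet_Ioi.prod (𝓗.le _ A hA))

lemma measurable_fst_predictable (𝓗 : Filtration ℝ≥0 mΩ) :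
    Measurable[𝓗.predictable] (Prod.fst : ℝ≥0 × Ω → ℝ≥0) := by
  let : MeasurableSpace (ℝ≥0 × Ω) := 𝓗.predictable
  refine measurable_of_Ioi fun t ↦ ?_
  have := measurableSet_predictable_Ioi_prod (𝓕 := 𝓗) (i := t) (s := univ) MeasurableSet.univ
  convert this using 1
  ext p
  simp

/-- For a real number `q` and an `𝓗 (max q 0)`-measurable variable `f`, the process
`1_{q < u} f` is predictable. -/
lemma measurable_predictable_indicator {q : ℝ} {f : Ω → ℝ≥0∞}
    (hf : Measurable[𝓗 q.toNNReal] f) :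
    Measurable[𝓗.predictable]
      (({p | q < (p.1 : ℝ)} : Set (ℝ≥0 × Ω)).indicator fun p ↦ f p.2) := by
  have hset : ∀ A, MeasurableSet[𝓗 q.toNNReal] A →
      MeasurableSet[𝓗.predictable] {p : ℝ≥0 × Ω | q < p.1 ∧ p.2 ∈ A} := by
    intro A hA
    rcases lt_or_ge q 0 with hq | hq
    · have h0 : q.toNNReal = ⊥ := by simpa using hq.le
      rw [h0] at hA
      have h1 := (measurableSet_predictable_singleton_bot_prod (𝓕 := 𝓗) hA)
      have h2 := (measurableSet_predictable_Ioi_prod (𝓕 := 𝓗) hA)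
      convert @MeasurableSet.union _ 𝓗.predictable _ _ h1 h2 using 1
      ext p
      have : q < p.1 := hq.trans_le p.1.2
      simp only [mem_ofPred_eq, this, true_and, mem_union, mem_prod, mem_singleton_iff, mem_Ioi,
        bot_eq_zero]
      have := eq_zero_or_pos p.1
      tauto
    · convert measurableSet_predictable_Ioi_prod (𝓕 := 𝓗) hA using 1
      ext p
      simp [Real.toNNReal_lt_iff_lt_coe hq]
  intro s hs
  rw [indicator_preimage]
  have hU := hset univ MeasurableSet.univ
  have hA := hset _ (hf hs)
  simp only [mem_univ, and_true] at hU
  rw [Set.ite]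
  refine @MeasurableSet.union _ 𝓗.predictable _ _ ?_ ?_
  · convert hA using 1
    ext p
    simp [and_comm]
  · exact @MeasurableSet.diff _ 𝓗.predictable _ _
      (@measurable_const _ _ _ 𝓗.predictable (0 : ℝ≥0∞) _ hs) hU

/-- The strict past `N|_{(-∞, u)}` of an adapted random measure is predictable in `(u, ω)`: for
each Borel set `B`, it is the supremum over rationals `q < u` of `N(B ∩ (-∞, q])`. -/
lemma measurable_restrict_Iio_predictable {N : Ω → Measure ℝ}
    (hN : ∀ t : ℝ≥0, Measurable[𝓗 t] fun ω ↦ (N ω).restrict (Iic (t : ℝ))) :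
    Measurable[𝓗.predictable] fun p : ℝ≥0 × Ω ↦ (N p.2).restrict (Iio (p.1 : ℝ)) := by
  refine @Measure.measurable_of_measurable_coe _ _ _ 𝓗.predictable _ fun B hB ↦ ?_
  have hsup : (fun p : ℝ≥0 × Ω ↦ (N p.2).restrict (Iio (p.1 : ℝ)) B) = fun p ↦
      ⨆ q : ℚ, ({p | (q : ℝ) < p.1} : Set (ℝ≥0 × Ω)).indicator
        (fun p ↦ N p.2 (B ∩ Iic (q : ℝ))) p := by
    ext ⟨u, ω⟩
    have hU : B ∩ Iio (u : ℝ) = ⋃ q : {q : ℚ // (q : ℝ) < u}, B ∩ Iic ((q : ℚ) : ℝ) := by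
      ext x
      simp only [mem_inter_iff, mem_Iio, mem_iUnion, mem_Iic, Subtype.exists, exists_prop]
      constructor
      · rintro ⟨hx, hxu⟩
        obtain ⟨q, hq1, hq2⟩ := exists_rat_btwn hxu
        exact ⟨q, hq2, hx, hq1.le⟩
      · rintro ⟨q, hq, hx, hxq⟩
        exact ⟨hx, hxq.trans_lt hq⟩
    have hmono : Monotone fun q : {q : ℚ // (q : ℝ) < u} ↦ B ∩ Iic ((q : ℚ) : ℝ) := by
      intro p q hpq
      refine inter_subset_inter_right _ (Iic_subset_Iic.2 ?_)
      exact_mod_cast hpq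
    rw [Measure.restrict_apply hB, hU, hmono.directed_le.measure_iUnion]
    simp only [indicator, mem_ofPred_eq]
    rw [iSup_subtype]
    refine iSup_congr fun q ↦ ?_
    split_ifs with hq <;> simp [hq]
  rw [hsup]
  let : MeasurableSpace (ℝ≥0 × Ω) := 𝓗.predictable
  refine Measurable.iSup fun q ↦ ?_
  refine measurable_predictable_indicator (𝓗 := 𝓗) (f := fun ω ↦ N ω (B ∩ Iic (q : ℝ))) ?_
  have := (Measure.measurable_coe (hB.inter (measurableSet_Iic (a := (q : ℝ))))).comp
    (hN (q : ℝ).toNNReal)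
  convert this using 1
  ext ω
  simp only [Function.comp_apply]
  rw [Measure.restrict_eq_self]
  exact inter_subset_right.trans (Iic_subset_Iic.2 (Real.le_coe_toNNReal _))

lemma IsAdaptedPointProcess.measurable_intensity {N : Ω → Measure ℝ}
    (hN : IsAdaptedPointProcess 𝓗 N) (lam : ℝ) {h : ℝ → ℝ} (hh : Measurable h) :
    Measurable[𝓗.predictable] fun p : ℝ≥0 × Ω ↦ intensity lam h (N p.2) (p.1 : ℝ) := by
  let : MeasurableSpace (ℝ≥0 × Ω) := 𝓗.predictable
  have hfst : Measurable (Prod.fst : ℝ≥0 × Ω → ℝ≥0) := measurable_fst_predictable 𝓗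
  have key : ∀ g : ℝ → ℝ, Measurable g → Measurable fun p : ℝ≥0 × Ω ↦
      ∫⁻ s in Iio (p.1 : ℝ), ENNReal.ofReal (g (p.1 - s)) ∂(N p.2) := by
    intro g hg
    refine measurable_lintegral_section (measurable_restrict_Iio_predictable hN.adapted)
      (fun p B hB ↦ (Measure.restrict_apply_le _ _).trans_lt
        ((hN.counting p.2).finite_of_isBounded B hB))
      (f := fun x : (ℝ≥0 × Ω) × ℝ ↦ ENNReal.ofReal (g (x.1.1 - x.2))) ?_
    have : Measurable fun x : (ℝ≥0 × Ω) × ℝ ↦ (x.1.1 : ℝ) :=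
      measurable_coe_nnreal_real.comp (hfst.comp measurable_fst)
    exact (hg.comp (this.sub measurable_snd)).ennreal_ofReal
  exact (measurable_const.add (key h hh)).sub (key (fun t ↦ -h t) hh.neg)

end Predictable

/-! ### Adaptedness of the iterates -/

lemma measurable_measure_restrict {α : Type*} [MeasurableSpace α] {s : Set α}
    (hs : MeasurableSet s) :
    Measurable fun μ : Measure α ↦ μ.restrict s :=
  Measure.measurable_of_measurable_coe _ fun B hB ↦ by
    simpa only [Measure.restrict_apply hB] using Measure.measurable_coe (hB.inter hs)

section Adapted

variable {Ω : Type*} {mΩ : MeasurableSpace Ω}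

/-- The data `N0` and `Q` are adapted to `𝓗`. Both the given filtration and the one generated
by the data have this property. -/
structure IsDriven (𝓗 : Filtration ℝ≥0 mΩ) (N0 : Ω → Measure ℝ) (Q : Ω → Measure (ℝ × ℝ)) :
    Prop where
  measurable_initial : Measurable[𝓗 0] N0
  counting_initial : ∀ ω, IsCountingMeasure (N0 ω)
  measurable_restrict : ∀ t : ℝ≥0,
    Measurable[𝓗 t] fun ω ↦ (Q ω).restrict (Ioc (0 : ℝ) t ×ˢ univ)
  counting : ∀ ω, IsCountingMeasure (Q ω)

variable {𝓗 : Filtration ℝ≥0 mΩ} {N0 : Ω → Measure ℝ} {Q : Ω → Measure (ℝ × ℝ)}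

lemma IsDriven.measurable_thinning_restrict (hd : IsDriven 𝓗 N0 Q) {Λ : Ω → ℝ → ℝ≥0∞}
    (hΛ : Measurable[𝓗.predictable] fun p : ℝ≥0 × Ω ↦ Λ p.2 (p.1 : ℝ)) (t : ℝ≥0) :
    Measurable[𝓗 t] fun ω ↦ (thinning (Q ω) (Λ ω)).restrict (Iic (t : ℝ)) := by
  have hprog : Measurable[(Subtype.instMeasurableSpace.prod (𝓗 t) :
      MeasurableSpace (Iic t × Ω))] fun x : Iic t × Ω ↦ Λ x.2 ((x.1 : ℝ≥0) : ℝ) :=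
    hΛ.comp measurable_inclusion_predictable
  let : MeasurableSpace Ω := 𝓗 t
  have hclip : Measurable fun x : Ω × (ℝ × ℝ) ↦
      ((⟨min x.2.1.toNNReal t, mem_Iic.2 (min_le_right _ _)⟩, x.1) : Iic t × Ω) := by
    refine Measurable.prodMk (Measurable.subtype_mk ?_) measurable_fst
    fun_prop
  have hΛ' : Measurable fun x : Ω × (ℝ × ℝ) ↦ Λ x.1 ((min x.2.1.toNNReal t : ℝ≥0) : ℝ) :=
    hprog.comp hclip
  refine Measure.measurable_of_measurable_coe _ fun B hB ↦ ?_
  have hS : MeasurableSet {x : Ω × (ℝ × ℝ) | x.2.1 ∈ B ∧ 0 < x.2.2 ∧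
      ENNReal.ofReal x.2.2 ≤ Λ x.1 ((min x.2.1.toNNReal t : ℝ≥0) : ℝ)} := by
    have h1 : Measurable fun x : Ω × (ℝ × ℝ) ↦ x.2.1 := by fun_prop
    have h2 : Measurable fun x : Ω × (ℝ × ℝ) ↦ x.2.2 := by fun_prop
    exact (h1 hB).inter ((measurableSet_lt measurable_const h2).inter
      (measurableSet_le h2.ennreal_ofReal hΛ'))
  have := measurable_measure_section (hd.measurable_restrict t)
    (fun ω A hA ↦ (Measure.restrict_apply_le _ _).trans_lt
      ((hd.counting ω).finite_of_isBounded A hA)) hS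
  convert this using 1
  ext ω
  have hm : MeasurableSet {e : ℝ × ℝ | (ω, e) ∈ {x : Ω × (ℝ × ℝ) | x.2.1 ∈ B ∧ 0 < x.2.2 ∧
      ENNReal.ofReal x.2.2 ≤ Λ x.1 ((min x.2.1.toNNReal t : ℝ≥0) : ℝ)}} :=
    measurable_prodMk_left hS
  rw [Measure.restrict_apply hB, thinning_apply _ _ (hB.inter measurableSet_Iic),
    Measure.restrict_apply hm]
  congr 1
  ext p
  simp only [region, mem_inter_iff, mem_preimage, mem_Iic, mem_ofPred_eq, mem_prod, mem_Ioc,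
    mem_univ, and_true]
  have hcl : 0 < p.1 → p.1 ≤ t → ((min p.1.toNNReal t : ℝ≥0) : ℝ) = p.1 := by
    intro h0 ht
    rw [NNReal.coe_min, Real.coe_toNNReal _ h0.le, min_eq_left ht]
  constructor
  · rintro ⟨⟨h1, h2⟩, h3, h4, h5⟩
    exact ⟨⟨h1, h4, by rwa [hcl h3 h2]⟩, h3, h2⟩
  · rintro ⟨⟨h1, h4, h5⟩, h3, h2⟩
    exact ⟨⟨h1, h2⟩, h3, h4, by rwa [hcl h3 h2] at h5⟩

lemma IsDriven.isAdaptedPointProcess_picard (hd : IsDriven 𝓗 N0 Q) (lam : ℝ) {h : ℝ → ℝ}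
    (hh : Measurable h) (n : ℕ) :
    IsAdaptedPointProcess 𝓗 fun ω ↦ picard lam h (N0 ω) (Q ω) n := by
  have hinit : ∀ t : ℝ≥0, Measurable[𝓗 t] fun ω ↦ (N0 ω).restrict (Iic (t : ℝ)) := fun t ↦
    (measurable_measure_restrict measurableSet_Iic).comp
      (hd.measurable_initial.mono (𝓗.mono zero_le) le_rfl)
  refine ⟨fun ω ↦ isCountingMeasure_picard hh (hd.counting_initial ω) (hd.counting ω) n, ?_⟩
  induction n with
  | zero => exact hinit
  | succ n ih =>
    intro t
    have hN : IsAdaptedPointProcess 𝓗 fun ω ↦ picard lam h (N0 ω) (Q ω) n :=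
      ⟨fun ω ↦ isCountingMeasure_picard hh (hd.counting_initial ω) (hd.counting ω) n, ih⟩
    have hΛ : Measurable[𝓗.predictable] fun p : ℝ≥0 × Ω ↦
        min (intensity lam h (picard lam h (N0 p.2) (Q p.2) n) (p.1 : ℝ)) n := by
      let : MeasurableSpace (ℝ≥0 × Ω) := 𝓗.predictable
      exact (hN.measurable_intensity lam hh).min measurable_const
    have hthin := hd.measurable_thinning_restrict
      (Λ := fun ω u ↦ min (intensity lam h (picard lam h (N0 ω) (Q ω) n) u) n) hΛ t
    simp only [picard, Measure.restrict_add]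
    let : MeasurableSpace Ω := 𝓗 t
    refine Measure.measurable_of_measurable_coe _ fun B hB ↦ ?_
    simp only [Measure.add_apply]
    exact ((Measure.measurable_coe hB).comp (hinit t)).add ((Measure.measurable_coe hB).comp hthin)

lemma IsDriven.measurable_picard_Ioc (hd : IsDriven 𝓗 N0 Q) (lam : ℝ) {h : ℝ → ℝ}
    (hh : Measurable h) (n : ℕ) (t : ℝ≥0) :
    Measurable[𝓗 t] fun ω ↦ picard lam h (N0 ω) (Q ω) n (Ioc 0 (t : ℝ)) := by
  have := (Measure.measurable_coe (measurableSet_Ioc (a := (0 : ℝ)) (b := t))).comp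
    ((hd.isAdaptedPointProcess_picard lam hh n).adapted t)
  convert this using 2 with ω
  simp only [Function.comp_apply]
  rw [Measure.restrict_eq_self _ Ioc_subset_Iic_self]

end Adapted

/-! ### The driving point process -/

section Driving

variable {Ω : Type*} {mΩ : MeasurableSpace Ω} {P : Measure Ω} {𝓕 : Filtration ℝ≥0 mΩ}
  {N0 : Ω → Measure ℝ} {Q : Ω → Measure (ℝ × ℝ)}

/-- The defining measurability on rectangles extends to the whole restriction to
`(0, t] × (0, ∞)`. -/
lemma IsPoissonPointProcess.measurable_restrict (hQ : IsPoissonPointProcess 𝓕 P Q) (t : ℝ≥0) :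
    Measurable[𝓕 t] fun ω ↦ (Q ω).restrict (Ioc (0 : ℝ) t ×ˢ univ) := by
  let : MeasurableSpace Ω := 𝓕 t
  -- rectangles whose left end stays away from `0`
  have hrect : ∀ (n : ℕ) (x y : ℝ), Measurable fun ω ↦
      Q ω (Ioc (1 / ((n : ℝ) + 1)) (min t x) ×ˢ Ioc 0 y) := by
    intro n x y
    rcases le_or_gt (min (t : ℝ) x) (1 / ((n : ℝ) + 1)) with hx | hx
    · simp only [Ioc_eq_empty (not_lt.2 hx), empty_prod, measure_empty, measurable_const]
    rcases le_or_gt y 0 with hy | hy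
    · simp [Ioc_eq_empty (not_lt.2 hy)]
    have hn : (0 : ℝ) < 1 / ((n : ℝ) + 1) := by positivity
    let a : ℝ≥0 := ⟨1 / ((n : ℝ) + 1), hn.le⟩
    let s : ℝ≥0 := ⟨min (t : ℝ) x - 1 / ((n : ℝ) + 1), by linarith⟩
    have has : ((a : ℝ) + s) = min (t : ℝ) x := add_sub_cancel (1 / ((n : ℝ) + 1)) (min (t : ℝ) x)
    have hs0 : 0 < s := sub_pos.2 hx
    have hle : a + s ≤ t := by
      rw [← NNReal.coe_le_coe, NNReal.coe_add, has]
      exact min_le_left _ _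
    have := (hQ.adapted a s ⟨y, hy.le⟩ hn hs0 hy).mono
      (𝓕.mono hle) le_rfl
    rw [has] at this
    exact this
  have hbox : ∀ n : ℕ, Measurable fun ω ↦
      (Q ω).restrict (Ioc (1 / ((n : ℝ) + 1)) t ×ˢ Ioc (0 : ℝ) n) := by
    intro n
    have : ∀ ω, IsFiniteMeasure ((Q ω).restrict (Ioc (1 / ((n : ℝ) + 1)) t ×ˢ Ioc (0 : ℝ) n)) :=
      fun ω ↦ ⟨by
        rw [Measure.restrict_apply_univ]
        exact (hQ.counting ω).finite_of_isBounded _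
          ((Metric.isBounded_Ioc _ _).prod (Metric.isBounded_Ioc _ _))⟩
    refine Measurable.measure_of_isPiSystem
      (S := image2 (· ×ˢ ·) (range (Iic : ℝ → Set ℝ)) (range (Iic : ℝ → Set ℝ))) ?_ ?_ ?_ ?_
    · have hspan : IsCountablySpanning (range (Iic : ℝ → Set ℝ)) :=
        ⟨fun n : ℕ ↦ Iic (n : ℝ), fun n ↦ ⟨n, rfl⟩,
          iUnion_eq_univ_iff.2 fun x ↦ exists_nat_ge x⟩
      exact (generateFrom_eq_prod (borel_eq_generateFrom_Iic ℝ ▸ BorelSpace.measurable_eq.symm)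
        (borel_eq_generateFrom_Iic ℝ ▸ BorelSpace.measurable_eq.symm) hspan hspan).symm
    · exact isPiSystem_Iic.prod isPiSystem_Iic
    · rintro _ ⟨_, ⟨x, rfl⟩, _, ⟨y, rfl⟩, rfl⟩
      have := hrect n x (min n y)
      convert this using 2 with ω
      rw [Measure.restrict_apply (measurableSet_Iic.prod measurableSet_Iic), prod_inter_prod,
        inter_comm, inter_comm (Iic y), Ioc_inter_Iic, Ioc_inter_Iic]
    · have := hrect n t n
      simpa using this
  refine Measure.measurable_of_measurable_coe _ fun B hB ↦ ?_
  have hmono : Monotone fun n : ℕ ↦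
      B ∩ Ioc (1 / ((n : ℝ) + 1)) (t : ℝ) ×ˢ Ioc (0 : ℝ) n := by
    intro m n hmn
    have hmn' : (m : ℝ) ≤ n := by exact_mod_cast hmn
    refine inter_subset_inter_right _
      (prod_mono (Ioc_subset_Ioc_left ?_) (Ioc_subset_Ioc_right hmn'))
    gcongr
  have hU : ⋃ n : ℕ, B ∩ Ioc (1 / ((n : ℝ) + 1)) (t : ℝ) ×ˢ Ioc (0 : ℝ) n
      = B ∩ Ioc (0 : ℝ) t ×ˢ Ioi 0 := by
    ext p
    simp only [mem_iUnion, mem_inter_iff, mem_prod, mem_Ioc, mem_Ioi]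
    constructor
    · rintro ⟨n, hB, ⟨h1, h2⟩, h3, h4⟩
      exact ⟨hB, ⟨lt_trans (by positivity) h1, h2⟩, h3⟩
    · rintro ⟨hB, ⟨h1, h2⟩, h3⟩
      obtain ⟨n, hn⟩ := exists_nat_one_div_lt h1
      obtain ⟨m, hm⟩ := exists_nat_ge p.2
      refine ⟨max n m, hB, ⟨lt_of_le_of_lt ?_ hn, h2⟩, h3, hm.trans (by simp)⟩
      have : (n : ℝ) ≤ (max n m : ℕ) := by exact_mod_cast le_max_left n m
      gcongr
  have : (fun ω ↦ (Q ω).restrict (Ioc (0 : ℝ) t ×ˢ univ) B) = fun ω ↦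
      ⨆ n : ℕ, (Q ω).restrict (Ioc (1 / ((n : ℝ) + 1)) t ×ˢ Ioc (0 : ℝ) n) B := by
    ext ω
    simp only [Measure.restrict_apply hB]
    rw [← hmono.measure_iUnion, hU]
    refine le_antisymm ?_ (measure_mono (inter_subset_inter_right _ (prod_mono subset_rfl
      (subset_univ _))))
    refine (measure_mono (t := B ∩ Ioc (0 : ℝ) t ×ˢ Ioi 0 ∪ (Ioi 0 ×ˢ Ioi 0)ᶜ) ?_).trans
      ((measure_union_le _ _).trans (by rw [hQ.quadrant ω, add_zero]))
    rintro p ⟨hB, hp, -⟩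
    by_cases h : 0 < p.2
    · exact Or.inl ⟨hB, hp, h⟩
    · exact Or.inr fun h' ↦ h h'.2
  rw [this]
  exact Measurable.iSup fun n ↦ (Measure.measurable_coe hB).comp (hbox n)

lemma IsPoissonPointProcess.isDriven (hQ : IsPoissonPointProcess 𝓕 P Q)
    (hN0 : IsInitialCondition 𝓕 N0) : IsDriven 𝓕 N0 Q :=
  ⟨hN0.measurable, hN0.counting, hQ.measurable_restrict, hQ.counting⟩

lemma IsDriven.drivingSigma_le (hd : IsDriven 𝓕 N0 Q) (t : ℝ≥0) : drivingSigma N0 Q t ≤ 𝓕 t := by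
  let : MeasurableSpace Ω := 𝓕 t
  exact ((hd.measurable_initial.mono (𝓕.mono zero_le) le_rfl).prodMk
    (hd.measurable_restrict t)).comap_le

/-- The filtration generated by the data. -/
noncomputable def drivingFiltration (hd : IsDriven 𝓕 N0 Q) : Filtration ℝ≥0 mΩ where
  seq t := drivingSigma N0 Q t
  mono' s t hst := by
    have hle : Ioc (0 : ℝ) s ×ˢ (univ : Set ℝ) ⊆ Ioc (0 : ℝ) t ×ˢ univ :=
      prod_mono (Ioc_subset_Ioc_right (by exact_mod_cast hst)) subset_rfl
    have : Measurable[drivingSigma N0 Q t]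
        fun ω ↦ (N0 ω, (Q ω).restrict (Ioc (0 : ℝ) s ×ˢ univ)) := by
      have h1 : Measurable[drivingSigma N0 Q t]
          fun ω ↦ (N0 ω, (Q ω).restrict (Ioc (0 : ℝ) t ×ˢ univ)) := comap_measurable _
      have h2 : Measurable fun x : Measure ℝ × Measure (ℝ × ℝ) ↦
          (x.1, x.2.restrict (Ioc (0 : ℝ) s ×ˢ univ)) :=
        measurable_fst.prodMk ((measurable_measure_restrict
          (measurableSet_Ioc.prod MeasurableSet.univ)).comp measurable_snd)
      convert h2.comp h1 using 2 with ω
      simp only [Function.comp_apply]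
      rw [Measure.restrict_restrict_of_subset hle]
    exact this.comap_le
  le' t := (hd.drivingSigma_le t).trans (𝓕.le t)

lemma IsDriven.drivingFiltration (hd : IsDriven 𝓕 N0 Q) :
    IsDriven (drivingFiltration hd) N0 Q where
  measurable_initial := measurable_fst.comp (comap_measurable _)
  counting_initial := hd.counting_initial
  measurable_restrict _ := measurable_snd.comp (comap_measurable _)
  counting := hd.counting

end Driving

/-! ### The compensation formula -/

lemma lintegral_natCast_poissonMeasure (r : ℝ≥0) :
    ∫⁻ n : ℕ, (n : ℝ≥0∞) ∂(poissonMeasure r) = r := by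
  have hsum : ∑' n : ℕ, ENNReal.ofReal (Real.exp (-r) * r ^ n / (n.factorial)) = 1 := by
    rw [← ENNReal.ofReal_tsum_of_nonneg (fun n ↦ by positivity)
      (hasSum_one_poissonMeasure r).summable, (hasSum_one_poissonMeasure r).tsum_eq,
      ENNReal.ofReal_one]
  rw [poissonMeasure, lintegral_sum_measure]
  simp only [lintegral_smul_measure, lintegral_dirac, smul_eq_mul]
  rw [tsum_eq_zero_add' ENNReal.summable]
  have : ∀ n : ℕ, ENNReal.ofReal (Real.exp (-r) * r ^ (n + 1) / ((n + 1).factorial))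
      * ((n + 1 : ℕ) : ℝ≥0∞) = r * ENNReal.ofReal (Real.exp (-r) * r ^ n / (n.factorial)) := by
    intro n
    rw [← ENNReal.ofReal_natCast (n + 1), ← ENNReal.ofReal_coe_nnreal (p := r),
      ← ENNReal.ofReal_mul (by positivity), ← ENNReal.ofReal_mul (by positivity)]
    congr 1
    rw [Nat.factorial_succ]
    push_cast
    field_simp
    ring
  simp_rw [this, ENNReal.tsum_mul_left, hsum]
  simp

section Compensation

variable {Ω : Type*} {mΩ : MeasurableSpace Ω} {P : Measure Ω}
  {𝓕 : Filtration ℝ≥0 mΩ} {Q : Ω → Measure (ℝ × ℝ)}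

lemma IsPoissonPointProcess.measurable_apply (hQ : IsPoissonPointProcess 𝓕 P Q)
    {S : Set (ℝ × ℝ)} (hS : MeasurableSet S) : Measurable fun ω ↦ Q ω S :=
  (Measure.measurable_coe hS).comp hQ.measurable

/-- The mean measure of a rectangle over an event of its past, away from time `0`. -/
lemma IsPoissonPointProcess.setLIntegral_rectangle_of_pos (hQ : IsPoissonPointProcess 𝓕 P Q)
    {i : ℝ≥0} (hi : 0 < i) (k y : ℝ) {A : Set Ω} (hA : MeasurableSet[𝓕 i] A) :
    ∫⁻ ω in A, Q ω (Ioc (i : ℝ) k ×ˢ Ioc 0 y) ∂P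
      = ENNReal.ofReal (k - i) * ENNReal.ofReal y * P A := by
  rcases le_or_gt k i with hk | hk
  · simp [Ioc_eq_empty (not_lt.2 hk), ENNReal.ofReal_of_nonpos (sub_nonpos.2 hk)]
  rcases le_or_gt y 0 with hy | hy
  · simp [Ioc_eq_empty (not_lt.2 hy), ENNReal.ofReal_of_nonpos hy]
  let s : ℝ≥0 := ⟨k - i, (sub_pos.2 hk).le⟩
  let a : ℝ≥0 := ⟨y, hy.le⟩
  have hs : 0 < s := sub_pos.2 hk
  have ha : 0 < a := hy
  have his : (i : ℝ) + s = k := add_sub_cancel (i : ℝ) k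
  have hind := hQ.indep i s a hi hs ha
  have hlaw := hQ.law i s a hi hs ha
  rw [his] at hind hlaw
  have hA' : MeasurableSet A := 𝓕.le i A hA
  have hX : Measurable fun ω ↦ Q ω (Ioc (i : ℝ) k ×ˢ Ioc (0 : ℝ) a) :=
    hQ.measurable_apply (measurableSet_Ioc.prod measurableSet_Ioc)
  have hmul := lintegral_mul_eq_lintegral_mul_lintegral_of_independent_measurableSpace
    (μ := P) hX.comap_le (𝓕.le i) hind (f := fun ω ↦ Q ω (Ioc (i : ℝ) k ×ˢ Ioc (0 : ℝ) a))
    (g := A.indicator 1) (comap_measurable _)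
    (by let : MeasurableSpace Ω := 𝓕 i; exact measurable_one.indicator hA)
  have hmean : ∫⁻ ω, Q ω (Ioc (i : ℝ) k ×ˢ Ioc (0 : ℝ) a) ∂P = (s * a : ℝ≥0) := by
    rw [← lintegral_natCast_poissonMeasure, ← lintegral_map (μ := poissonMeasure (s * a))
      (f := fun x : ℝ≥0∞ ↦ x) measurable_id (by fun_prop), ← hlaw.map_eq,
      lintegral_map (f := fun x : ℝ≥0∞ ↦ x) measurable_id hX]
  rw [hmean, lintegral_indicator_one hA'] at hmul
  rw [← lintegral_indicator hA']
  have e1 : ENNReal.ofReal (k - i) = s := ENNReal.ofReal_eq_coe_nnreal _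
  have e2 : ENNReal.ofReal y = a := ENNReal.ofReal_eq_coe_nnreal _
  rw [e1, e2, ← ENNReal.coe_mul, ← hmul]
  refine lintegral_congr fun ω ↦ ?_
  change A.indicator (fun ω ↦ Q ω (Ioc (i : ℝ) k ×ˢ Ioc (0 : ℝ) a)) ω = _
  by_cases hω : ω ∈ A <;> simp [hω]

variable [IsProbabilityMeasure P]

lemma IsPoissonPointProcess.setLIntegral_rectangle (hQ : IsPoissonPointProcess 𝓕 P Q)
    (i : ℝ≥0) (k y : ℝ) {A : Set Ω} (hA : MeasurableSet[𝓕 i] A) :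
    ∫⁻ ω in A, Q ω (Ioc (i : ℝ) k ×ˢ Ioc 0 y) ∂P
      = ENNReal.ofReal (k - i) * ENNReal.ofReal y * P A := by
  rcases eq_zero_or_pos i with rfl | hi
  swap
  · exact hQ.setLIntegral_rectangle_of_pos hi k y hA
  -- exhaust `(0, k]` by the intervals `(1 / (n + 1), k]`
  have hmono : Monotone fun n : ℕ ↦ Ioc (1 / ((n : ℝ) + 1)) k ×ˢ Ioc 0 y := by
    intro m n hmn
    have hmn' : (m : ℝ) ≤ n := by exact_mod_cast hmn
    refine prod_mono (Ioc_subset_Ioc_left ?_) subset_rfl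
    gcongr
  have hU : ⋃ n : ℕ, Ioc (1 / ((n : ℝ) + 1)) k ×ˢ Ioc 0 y = Ioc ((0 : ℝ≥0) : ℝ) k ×ˢ Ioc 0 y := by
    ext p
    simp only [mem_iUnion, mem_prod, mem_Ioc, NNReal.coe_zero]
    constructor
    · rintro ⟨n, ⟨h1, h2⟩, h3⟩
      exact ⟨⟨lt_trans (by positivity) h1, h2⟩, h3⟩
    · rintro ⟨⟨h1, h2⟩, h3⟩
      obtain ⟨n, hn⟩ := exists_nat_one_div_lt h1
      exact ⟨n, ⟨hn, h2⟩, h3⟩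
  have hlim1 : Tendsto (fun n : ℕ ↦ ∫⁻ ω in A, Q ω (Ioc (1 / ((n : ℝ) + 1)) k ×ˢ Ioc 0 y) ∂P)
      atTop (𝓝 (∫⁻ ω in A, Q ω (Ioc ((0 : ℝ≥0) : ℝ) k ×ˢ Ioc 0 y) ∂P)) := by
    refine lintegral_tendsto_of_tendsto_of_monotone (fun n ↦ (hQ.measurable_apply
      (measurableSet_Ioc.prod measurableSet_Ioc)).aemeasurable) (ae_of_all _ fun ω m n hmn ↦
        measure_mono (hmono hmn)) (ae_of_all _ fun ω ↦ ?_)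
    rw [← hU]
    exact tendsto_measure_iUnion_atTop hmono
  have hlim2 : Tendsto (fun n : ℕ ↦ ENNReal.ofReal (k - 1 / ((n : ℝ) + 1)) * ENNReal.ofReal y * P A)
      atTop (𝓝 (ENNReal.ofReal (k - ((0 : ℝ≥0) : ℝ)) * ENNReal.ofReal y * P A)) := by
    refine ENNReal.Tendsto.mul_const (ENNReal.Tendsto.mul_const ?_ (Or.inr (by finiteness)))
      (Or.inr (by finiteness))
    exact ENNReal.tendsto_ofReal (tendsto_const_nhds.sub tendsto_one_div_add_atTop_nhds_zero_nat)
  refine tendsto_nhds_unique hlim1 (hlim2.congr fun n ↦ ?_)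
  have hn : (0 : ℝ) < 1 / ((n : ℝ) + 1) := by positivity
  exact (hQ.setLIntegral_rectangle_of_pos (i := ⟨1 / ((n : ℝ) + 1), hn.le⟩) hn k y
    (𝓕.mono zero_le A hA)).symm

lemma isPiSystem_predictable (𝓕 : Filtration ℝ≥0 mΩ) :
    IsPiSystem ({s : Set (ℝ≥0 × Ω) | ∃ A, MeasurableSet[𝓕 ⊥] A ∧ s = {⊥} ×ˢ A} ∪
      {s | ∃ i A, MeasurableSet[𝓕 i] A ∧ s = Ioi i ×ˢ A}) := by
  rintro _ (⟨A, hA, rfl⟩ | ⟨i, A, hA, rfl⟩) _ (⟨B, hB, rfl⟩ | ⟨j, B, hB, rfl⟩) hne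
  · exact Or.inl ⟨A ∩ B, @MeasurableSet.inter _ (𝓕 ⊥) _ _ hA hB, by
      rw [prod_inter_prod, inter_self]⟩
  · obtain ⟨p, hp, hp'⟩ := hne
    exact absurd (hp.1 ▸ hp'.1 : j < ⊥) not_lt_bot
  · obtain ⟨p, hp, hp'⟩ := hne
    exact absurd (hp'.1 ▸ hp.1 : i < ⊥) not_lt_bot
  · refine Or.inr ⟨i ⊔ j, A ∩ B, ?_, by rw [prod_inter_prod, Ioi_inter_Ioi]⟩
    exact @MeasurableSet.inter _ (𝓕 (i ⊔ j)) _ _ (𝓕.mono le_sup_left A hA)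
      (𝓕.mono le_sup_right B hB)

lemma isCountablySpanning_predictable (𝓕 : Filtration ℝ≥0 mΩ) :
    IsCountablySpanning ({s : Set (ℝ≥0 × Ω) | ∃ A, MeasurableSet[𝓕 ⊥] A ∧ s = {⊥} ×ˢ A} ∪
      {s | ∃ i A, MeasurableSet[𝓕 i] A ∧ s = Ioi i ×ˢ A}) := by
  refine ⟨fun n ↦ if n = 0 then {⊥} ×ˢ univ else Ioi 0 ×ˢ univ, fun n ↦ ?_, ?_⟩
  · dsimp only
    split_ifs
    · exact Or.inl ⟨univ, MeasurableSet.univ, rfl⟩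
    · exact Or.inr ⟨0, univ, MeasurableSet.univ, rfl⟩
  · refine iUnion_eq_univ_iff.2 fun p ↦ ?_
    rcases eq_zero_or_pos p.1 with h | h
    · exact ⟨0, by simp [h]⟩
    · exact ⟨1, by simpa using h⟩

/-- Compensation formula on the bounded box `(0, k] × (0, k]`: the two sides define finite measures
on `(ℝ≥0 × Ω) × ℝ`, which agree on the products of a generator of the predictable σ-algebra and a
half line. -/
lemma IsPoissonPointProcess.lintegral_box (hQ : IsPoissonPointProcess 𝓕 P Q) (k : ℕ)
    {H : (ℝ≥0 × Ω) × ℝ → ℝ≥0∞} (hH : Measurable[𝓕.predictable.prod inferInstance] H) :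
    ∫⁻ ω, ∫⁻ p in Ioc (0 : ℝ) k ×ˢ Ioc (0 : ℝ) k, H ((p.1.toNNReal, ω), p.2) ∂(Q ω) ∂P
      = ∫⁻ ω, ∫⁻ p in Ioc (0 : ℝ) k ×ˢ Ioc (0 : ℝ) k, H ((p.1.toNNReal, ω), p.2) ∂volume ∂P := by
  have hbox : MeasurableSet (Ioc (0 : ℝ) k ×ˢ Ioc (0 : ℝ) k) :=
    measurableSet_Ioc.prod measurableSet_Ioc
  have hbdd : Bornology.IsBounded (Ioc (0 : ℝ) k ×ˢ Ioc (0 : ℝ) k) :=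
    (Metric.isBounded_Ioc _ _).prod (Metric.isBounded_Ioc _ _)
  let κ : Kernel Ω (ℝ × ℝ) := ⟨fun ω ↦ (Q ω).restrict (Ioc (0 : ℝ) k ×ˢ Ioc (0 : ℝ) k),
    (measurable_measure_restrict hbox).comp hQ.measurable⟩
  let η : Kernel Ω (ℝ × ℝ) := Kernel.const Ω (volume.restrict (Ioc (0 : ℝ) k ×ˢ Ioc (0 : ℝ) k))
  have : IsSFiniteKernel κ := isSFiniteKernel_of_isFiniteMeasure κ fun ω ↦
    ⟨by simpa [κ] using (hQ.counting ω).finite_of_isBounded _ hbdd⟩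
  have hφ' : Measurable fun x : Ω × (ℝ × ℝ) ↦ (x.2.1.toNNReal, x.1) := by fun_prop
  have hφ₁ : Measurable[inferInstance, 𝓕.predictable]
      fun x : Ω × (ℝ × ℝ) ↦ (x.2.1.toNNReal, x.1) := hφ'.mono le_rfl (predictable_le_prod 𝓕)
  have hpi := (isPiSystem_predictable 𝓕).prod (isPiSystem_Iic (α := ℝ))
  have hspan := isCountablySpanning_predictable 𝓕
  have hspan' : IsCountablySpanning (range (Iic : ℝ → Set ℝ)) :=
    ⟨fun n : ℕ ↦ Iic (n : ℝ), fun n ↦ ⟨n, rfl⟩, iUnion_eq_univ_iff.2 fun x ↦ exists_nat_ge x⟩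
  let : MeasurableSpace (ℝ≥0 × Ω) := 𝓕.predictable
  have hφ : Measurable fun x : Ω × (ℝ × ℝ) ↦ ((x.2.1.toNNReal, x.1), x.2.2) :=
    hφ₁.prodMk (measurable_snd.comp measurable_snd)
  have hμκ : ∀ H : (ℝ≥0 × Ω) × ℝ → ℝ≥0∞, Measurable H →
      ∫⁻ x, H x ∂((P ⊗ₘ κ).map fun x : Ω × (ℝ × ℝ) ↦ ((x.2.1.toNNReal, x.1), x.2.2))
        = ∫⁻ ω, ∫⁻ p in Ioc (0 : ℝ) k ×ˢ Ioc (0 : ℝ) k, H ((p.1.toNNReal, ω), p.2) ∂(Q ω) ∂P := by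
    intro H hH
    rw [lintegral_map hH hφ]
    exact Measure.lintegral_compProd (μ := P) (κ := κ) (hH.comp hφ)
  have hμη : ∀ H : (ℝ≥0 × Ω) × ℝ → ℝ≥0∞, Measurable H →
      ∫⁻ x, H x ∂((P ⊗ₘ η).map fun x : Ω × (ℝ × ℝ) ↦ ((x.2.1.toNNReal, x.1), x.2.2))
        = ∫⁻ ω, ∫⁻ p in Ioc (0 : ℝ) k ×ˢ Ioc (0 : ℝ) k, H ((p.1.toNNReal, ω), p.2) ∂volume ∂P := by
    intro H hH
    rw [lintegral_map hH hφ]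
    exact Measure.lintegral_compProd (μ := P) (κ := η) (hH.comp hφ)
  rw [← hμκ H hH, ← hμη H hH]
  congr 1
  have hset : ∀ (R : Measure (ℝ × ℝ)) (ω : Ω) {S : Set ((ℝ≥0 × Ω) × ℝ)}, MeasurableSet S →
      ∫⁻ p in Ioc (0 : ℝ) k ×ˢ Ioc (0 : ℝ) k,
          S.indicator (1 : (ℝ≥0 × Ω) × ℝ → ℝ≥0∞) ((p.1.toNNReal, ω), p.2) ∂(R)
        = R ({p | ((p.1.toNNReal, ω), p.2) ∈ S} ∩ Ioc (0 : ℝ) k ×ˢ Ioc (0 : ℝ) k) := by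
    intro R ω S hS
    have hm : MeasurableSet {p : ℝ × ℝ | ((p.1.toNNReal, ω), p.2) ∈ S} :=
      (hφ.comp measurable_prodMk_left) hS
    rw [← Measure.restrict_apply hm, ← lintegral_indicator_one hm]
    rfl
  have hκS : ∀ S : Set ((ℝ≥0 × Ω) × ℝ), MeasurableSet S →
      ((P ⊗ₘ κ).map fun x : Ω × (ℝ × ℝ) ↦ ((x.2.1.toNNReal, x.1), x.2.2)) S
        = ∫⁻ ω, Q ω ({p | ((p.1.toNNReal, ω), p.2) ∈ S} ∩ Ioc (0 : ℝ) k ×ˢ Ioc (0 : ℝ) k) ∂P := by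
    intro S hS
    rw [← lintegral_indicator_one hS, hμκ _ (measurable_one.indicator hS)]
    exact lintegral_congr fun ω ↦ hset _ ω hS
  have hηS : ∀ S : Set ((ℝ≥0 × Ω) × ℝ), MeasurableSet S →
      ((P ⊗ₘ η).map fun x : Ω × (ℝ × ℝ) ↦ ((x.2.1.toNNReal, x.1), x.2.2)) S
        = ∫⁻ ω, volume ({p : ℝ × ℝ | ((p.1.toNNReal, ω), p.2) ∈ S}
            ∩ Ioc (0 : ℝ) k ×ˢ Ioc (0 : ℝ) k) ∂P := by
    intro S hS
    rw [← lintegral_indicator_one hS, hμη _ (measurable_one.indicator hS)]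
    exact lintegral_congr fun ω ↦ hset _ ω hS
  have hvol : ∀ a b y : ℝ, (volume : Measure (ℝ × ℝ)) (Ioc a b ×ˢ Ioc 0 y)
      = ENNReal.ofReal (b - a) * ENNReal.ofReal y := by
    intro a b y
    rw [Measure.volume_eq_prod, Measure.prod_prod, Real.volume_Ioc, Real.volume_Ioc, sub_zero]
  have huniv : ((P ⊗ₘ κ).map fun x : Ω × (ℝ × ℝ) ↦ ((x.2.1.toNNReal, x.1), x.2.2)) univ
      = ENNReal.ofReal k * ENNReal.ofReal k := by
    rw [hκS _ MeasurableSet.univ]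
    have := hQ.setLIntegral_rectangle 0 k k (A := univ) MeasurableSet.univ
    simpa using this
  have : IsFiniteMeasure
      ((P ⊗ₘ κ).map fun x : Ω × (ℝ × ℝ) ↦ ((x.2.1.toNNReal, x.1), x.2.2)) :=
    ⟨by rw [huniv]; finiteness⟩
  refine ext_of_generate_finite _ (generateFrom_eq_prod rfl
    (borel_eq_generateFrom_Iic ℝ ▸ BorelSpace.measurable_eq.symm) hspan
    hspan').symm hpi ?_ ?_
  · rintro _ ⟨_, hC, _, ⟨y, rfl⟩, rfl⟩
    have hCm : MeasurableSet (_ : Set (ℝ≥0 × Ω)) := MeasurableSpace.measurableSet_generateFrom hC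
    rw [hκS _ (hCm.prod measurableSet_Iic), hηS _ (hCm.prod measurableSet_Iic)]
    rcases hC with ⟨A, hA, rfl⟩ | ⟨i, A, hA, rfl⟩
    · have : ∀ ω, {p : ℝ × ℝ | ((p.1.toNNReal, ω), p.2) ∈ (({⊥} : Set ℝ≥0) ×ˢ A) ×ˢ Iic y}
          ∩ Ioc (0 : ℝ) k ×ˢ Ioc (0 : ℝ) k = ∅ := by
        intro ω
        ext p
        simp only [mem_inter_iff, mem_ofPred_eq, mem_prod, mem_singleton_iff, mem_Ioc,
          mem_empty_iff_false, iff_false]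
        rintro ⟨⟨⟨h, -⟩, -⟩, ⟨h0, -⟩, -⟩
        exact (Real.toNNReal_pos.2 h0).ne' h
      simp only [this, measure_empty]
    · have hsec : ∀ ω, {p : ℝ × ℝ | ((p.1.toNNReal, ω), p.2) ∈ (Ioi i ×ˢ A) ×ˢ Iic y}
          ∩ Ioc (0 : ℝ) k ×ˢ Ioc (0 : ℝ) k
            = {p | ω ∈ A ∧ p ∈ Ioc (i : ℝ) k ×ˢ Ioc (0 : ℝ) (min k y)} := by
        intro ω
        ext p
        simp only [mem_inter_iff, mem_ofPred_eq, mem_prod, mem_Ioc, mem_Ioi, mem_Iic,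
          Real.lt_toNNReal_iff_coe_lt, le_min_iff]
        constructor
        · tauto
        · rintro ⟨h1, ⟨h2, h3⟩, h4, h5, h6⟩
          exact ⟨⟨⟨h2, h1⟩, h6⟩, ⟨i.2.trans_lt h2, h3⟩, h4, h5⟩
      have hA' : MeasurableSet A := 𝓕.le i A hA
      have hind : ∀ R : Ω → Measure (ℝ × ℝ),
          ∫⁻ ω, R ω {p | ω ∈ A ∧ p ∈ Ioc (i : ℝ) k ×ˢ Ioc (0 : ℝ) (min k y)} ∂P
            = ∫⁻ ω in A, R ω (Ioc (i : ℝ) k ×ˢ Ioc (0 : ℝ) (min k y)) ∂P := by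
        intro R
        rw [← lintegral_indicator hA']
        refine lintegral_congr fun ω ↦ ?_
        by_cases hω : ω ∈ A
        · simp only [hω, true_and, indicator_of_mem]
          rfl
        · simp [hω]
      simp only [hsec]
      rw [hind, hind, hQ.setLIntegral_rectangle i k _ hA, hvol]
      simp
  · rw [huniv, hηS _ MeasurableSet.univ]
    simp [hvol]

/-- Compensation formula: for the expected value of integrals of predictable integrands, the
Poisson point process may be replaced by Lebesgue measure. -/
theorem IsPoissonPointProcess.lintegral_eq (hQ : IsPoissonPointProcess 𝓕 P Q)
    {H : (ℝ≥0 × Ω) × ℝ → ℝ≥0∞} (hH : Measurable[𝓕.predictable.prod inferInstance] H) :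
    ∫⁻ ω, ∫⁻ p in Ioi 0 ×ˢ Ioi 0, H ((p.1.toNNReal, ω), p.2) ∂(Q ω) ∂P
      = ∫⁻ ω, ∫⁻ p in Ioi (0 : ℝ) ×ˢ Ioi (0 : ℝ), H ((p.1.toNNReal, ω), p.2) ∂volume ∂P := by
  have hφ' : Measurable fun x : Ω × (ℝ × ℝ) ↦ (x.2.1.toNNReal, x.1) := by fun_prop
  have hφ₁ : Measurable[inferInstance, 𝓕.predictable]
      fun x : Ω × (ℝ × ℝ) ↦ (x.2.1.toNNReal, x.1) := hφ'.mono le_rfl (predictable_le_prod 𝓕)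
  have hHφ : Measurable fun x : Ω × (ℝ × ℝ) ↦ H ((x.2.1.toNNReal, x.1), x.2.2) := by
    let : MeasurableSpace (ℝ≥0 × Ω) := 𝓕.predictable
    exact hH.comp (hφ₁.prodMk (measurable_snd.comp measurable_snd))
  have hbox : ∀ k : ℕ, MeasurableSet (Ioc (0 : ℝ) k ×ˢ Ioc (0 : ℝ) k) := fun k ↦
    measurableSet_Ioc.prod measurableSet_Ioc
  have hmono : Monotone fun k : ℕ ↦ Ioc (0 : ℝ) k ×ˢ Ioc (0 : ℝ) k := fun m n hmn ↦
    prod_mono (Ioc_subset_Ioc_right (by exact_mod_cast hmn))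
      (Ioc_subset_Ioc_right (by exact_mod_cast hmn))
  have hU : Ioi (0 : ℝ) ×ˢ Ioi (0 : ℝ) = ⋃ k : ℕ, Ioc (0 : ℝ) k ×ˢ Ioc (0 : ℝ) k := by
    ext p
    simp only [mem_iUnion, mem_prod, mem_Ioc, mem_Ioi]
    constructor
    · rintro ⟨h1, h2⟩
      obtain ⟨k, hk⟩ := exists_nat_ge (max p.1 p.2)
      exact ⟨k, ⟨h1, (le_max_left _ _).trans hk⟩, h2, (le_max_right _ _).trans hk⟩
    · rintro ⟨k, h1, h2⟩
      exact ⟨h1.1, h2.1⟩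
  have key : ∀ R : Ω → Measure (ℝ × ℝ), Measurable R →
      (∀ ω, ∀ B, Bornology.IsBounded B → R ω B < ∞) →
      ∫⁻ ω, ∫⁻ p in Ioi 0 ×ˢ Ioi 0, H ((p.1.toNNReal, ω), p.2) ∂(R ω) ∂P
        = ⨆ k : ℕ, ∫⁻ ω, ∫⁻ p in Ioc (0 : ℝ) k ×ˢ Ioc (0 : ℝ) k,
            H ((p.1.toNNReal, ω), p.2) ∂(R ω) ∂P := by
    intro R hR hfin
    rw [← lintegral_iSup]
    · refine lintegral_congr fun ω ↦ ?_
      rw [hU]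
      exact setLIntegral_iUnion_of_directed _ hmono.directed_le
    · intro k
      exact measurable_lintegral_section ((measurable_measure_restrict (hbox k)).comp hR)
        (fun ω B hB ↦ (Measure.restrict_apply_le _ _).trans_lt (hfin ω B hB)) hHφ
    · intro m n hmn ω
      exact lintegral_mono_set (hmono hmn)
  rw [key Q hQ.measurable fun ω ↦ (hQ.counting ω).finite_of_isBounded,
    key (fun _ ↦ volume) measurable_const fun _ B hB ↦ hB.measure_lt_top]
  exact iSup_congr fun k ↦ hQ.lintegral_box k hH

end Compensation

/-! ### The conditional intensity of a thinning -/

section Expectation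

variable {Ω : Type*} {mΩ : MeasurableSpace Ω} {P : Measure Ω} [IsProbabilityMeasure P]
  {𝓕 : Filtration ℝ≥0 mΩ} {Q : Ω → Measure (ℝ × ℝ)} {N0 : Ω → Measure ℝ}

lemma setLIntegral_thinning (q : Measure (ℝ × ℝ)) {Λ : ℝ → ℝ≥0∞} (hΛ : Measurable Λ)
    {f : ℝ → ℝ≥0∞} (hf : Measurable f) :
    ∫⁻ u in Ioi 0, f u ∂(thinning q Λ) = ∫⁻ p in Ioi (0 : ℝ) ×ˢ Ioi (0 : ℝ),
      {p : ℝ × ℝ | ENNReal.ofReal p.2 ≤ Λ p.1}.indicator (fun p ↦ f p.1) p ∂q := by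
  have hm : MeasurableSet {p : ℝ × ℝ | ENNReal.ofReal p.2 ≤ Λ p.1} :=
    measurableSet_le (ENNReal.measurable_ofReal.comp measurable_snd) (hΛ.comp measurable_fst)
  rw [thinning, setLIntegral_map measurableSet_Ioi hf measurable_fst,
    Measure.restrict_restrict (measurable_fst measurableSet_Ioi), lintegral_indicator hm,
    Measure.restrict_restrict hm]
  congr 2
  ext p
  simp only [mem_inter_iff, mem_preimage, mem_Ioi, mem_ofPred_eq, mem_prod]
  tauto

lemma volume_setOf_ofReal_le (x : ℝ≥0∞) :
    (volume.restrict (Ioi (0 : ℝ))) {θ : ℝ | ENNReal.ofReal θ ≤ x} = x := by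
  rw [Measure.restrict_apply (measurableSet_le ENNReal.measurable_ofReal measurable_const)]
  rcases eq_or_ne x ∞ with rfl | hx
  · simp
  · have : {θ : ℝ | ENNReal.ofReal θ ≤ x} ∩ Ioi 0 = Ioc 0 x.toReal := by
      ext θ
      simp only [mem_inter_iff, mem_ofPred_eq, mem_Ioi, mem_Ioc, ENNReal.ofReal_le_iff_le_toReal hx]
      tauto
    rw [this, Real.volume_Ioc, sub_zero, ENNReal.ofReal_toReal hx]

/-- The points of `Q` below the graph of a predictable process `Λ` form a point process with
conditional intensity `Λ`. -/
lemma IsPoissonPointProcess.lintegral_thinning (hQ : IsPoissonPointProcess 𝓕 P Q)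
    {Λ : Ω → ℝ → ℝ≥0∞} (hΛ : Measurable[𝓕.predictable] fun p : ℝ≥0 × Ω ↦ Λ p.2 (p.1 : ℝ))
    (hΛ' : ∀ ω, Measurable (Λ ω)) {C : ℝ≥0 × Ω → ℝ≥0∞} (hC : Measurable[𝓕.predictable] C) :
    ∫⁻ ω, ∫⁻ u in Ioi (0 : ℝ), C (u.toNNReal, ω) ∂(thinning (Q ω) (Λ ω)) ∂P
      = ∫⁻ ω, ∫⁻ u in Ioi (0 : ℝ), C (u.toNNReal, ω) * Λ ω u ∂volume ∂P := by
  have hCω : ∀ ω, Measurable fun u : ℝ ↦ C (u.toNNReal, ω) := fun ω ↦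
    (hC.mono (predictable_le_prod 𝓕) le_rfl).comp (by fun_prop)
  have hH : Measurable[𝓕.predictable.prod inferInstance] fun x : (ℝ≥0 × Ω) × ℝ ↦
      {x : (ℝ≥0 × Ω) × ℝ | ENNReal.ofReal x.2 ≤ Λ x.1.2 (x.1.1 : ℝ)}.indicator
        (fun x ↦ C x.1) x := by
    let : MeasurableSpace (ℝ≥0 × Ω) := 𝓕.predictable
    exact (hC.comp measurable_fst).indicator
      (measurableSet_le (ENNReal.measurable_ofReal.comp measurable_snd) (hΛ.comp measurable_fst))
  have hpos : ∀ (R : Measure (ℝ × ℝ)) (ω : Ω), ∫⁻ p in Ioi (0 : ℝ) ×ˢ Ioi (0 : ℝ),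
      {p : ℝ × ℝ | ENNReal.ofReal p.2 ≤ Λ ω p.1}.indicator
        (fun p ↦ C (p.1.toNNReal, ω)) p ∂(R)
      = ∫⁻ p in Ioi (0 : ℝ) ×ˢ Ioi (0 : ℝ),
        {x : (ℝ≥0 × Ω) × ℝ | ENNReal.ofReal x.2 ≤ Λ x.1.2 (x.1.1 : ℝ)}.indicator
          (fun x ↦ C x.1) ((p.1.toNNReal, ω), p.2) ∂(R) := by
    intro R ω
    refine setLIntegral_congr_fun (measurableSet_Ioi.prod measurableSet_Ioi) fun p hp ↦ ?_
    have : ((p.1.toNNReal : ℝ≥0) : ℝ) = p.1 := Real.coe_toNNReal _ (le_of_lt hp.1)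
    simp only [indicator, mem_ofPred_eq, this]
  have e1 : ∀ ω, ∫⁻ u in Ioi (0 : ℝ), C (u.toNNReal, ω) ∂(thinning (Q ω) (Λ ω)) = _ := fun ω ↦
    (setLIntegral_thinning (Q ω) (hΛ' ω) (hCω ω)).trans (hpos _ ω)
  have e2 : ∀ ω, ∫⁻ u in Ioi (0 : ℝ), C (u.toNNReal, ω) * Λ ω u ∂volume
      = ∫⁻ p in Ioi (0 : ℝ) ×ˢ Ioi (0 : ℝ),
        {p : ℝ × ℝ | ENNReal.ofReal p.2 ≤ Λ ω p.1}.indicator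
          (fun p ↦ C (p.1.toNNReal, ω)) p ∂volume := by
    intro ω
    have hm : MeasurableSet {p : ℝ × ℝ | ENNReal.ofReal p.2 ≤ Λ ω p.1} :=
      measurableSet_le (ENNReal.measurable_ofReal.comp measurable_snd)
        ((hΛ' ω).comp measurable_fst)
    have hCm : Measurable fun p : ℝ × ℝ ↦ C (p.1.toNNReal, ω) := (hCω ω).comp measurable_fst
    rw [Measure.volume_eq_prod, ← Measure.prod_restrict,
      lintegral_prod _ (hCm.indicator hm).aemeasurable]
    refine lintegral_congr fun u ↦ ?_
    have : ∀ θ, {p : ℝ × ℝ | ENNReal.ofReal p.2 ≤ Λ ω p.1}.indicator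
        (fun p ↦ C (p.1.toNNReal, ω)) (u, θ)
        = {θ : ℝ | ENNReal.ofReal θ ≤ Λ ω u}.indicator (fun _ ↦ C (u.toNNReal, ω)) θ := fun θ ↦ rfl
    simp only [this]
    rw [lintegral_indicator_const (measurableSet_le ENNReal.measurable_ofReal measurable_const),
      volume_setOf_ofReal_le]
  simp_rw [e1, e2, hpos]
  exact hQ.lintegral_eq hH

lemma measurable_predictable_indicator_Ioc (𝓕 : Filtration ℝ≥0 mΩ) (t : ℝ) :
    Measurable[𝓕.predictable]
      ({p : ℝ≥0 × Ω | (p.1 : ℝ) ∈ Ioc 0 t}.indicator (1 : ℝ≥0 × Ω → ℝ≥0∞)) := by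
  have hfst := measurable_fst_predictable 𝓕
  let : MeasurableSpace (ℝ≥0 × Ω) := 𝓕.predictable
  exact measurable_one.indicator ((measurable_coe_nnreal_real.comp hfst) measurableSet_Ioc)

lemma setLIntegral_Ioi_indicator_Ioc (μ : Measure ℝ) (f : ℝ → ℝ≥0∞) (ω : Ω) (t : ℝ) :
    ∫⁻ u in Ioi 0, {p : ℝ≥0 × Ω | (p.1 : ℝ) ∈ Ioc 0 t}.indicator (1 : ℝ≥0 × Ω → ℝ≥0∞)
      (u.toNNReal, ω) * f u ∂μ = ∫⁻ u in Ioc 0 t, f u ∂μ := by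
  rw [← lintegral_indicator measurableSet_Ioi, ← lintegral_indicator measurableSet_Ioc]
  refine lintegral_congr fun u ↦ ?_
  by_cases hu : 0 < u
  · have h1 : ((u.toNNReal : ℝ≥0) : ℝ) = u := Real.coe_toNNReal _ hu.le
    by_cases hut : u ≤ t
    · simp [indicator, hu, hut, h1]
    · simp [indicator, hu, hut, h1]
  · simp [indicator, hu]

/-- Expected number of points of a thinning. -/
lemma IsPoissonPointProcess.lintegral_thinning_Ioc (hQ : IsPoissonPointProcess 𝓕 P Q)
    {Λ : Ω → ℝ → ℝ≥0∞} (hΛ : Measurable[𝓕.predictable] fun p : ℝ≥0 × Ω ↦ Λ p.2 (p.1 : ℝ))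
    (hΛ' : ∀ ω, Measurable (Λ ω)) (t : ℝ) :
    ∫⁻ ω, thinning (Q ω) (Λ ω) (Ioc 0 t) ∂P = ∫⁻ ω, ∫⁻ u in Ioc 0 t, Λ ω u ∂volume ∂P := by
  have := hQ.lintegral_thinning hΛ hΛ' (measurable_predictable_indicator_Ioc 𝓕 t)
  simp only [setLIntegral_Ioi_indicator_Ioc] at this
  rw [← this]
  refine lintegral_congr fun ω ↦ ?_
  have := setLIntegral_Ioi_indicator_Ioc (thinning (Q ω) (Λ ω)) 1 ω t
  simpa using this.symm

/-! ### Moment bound for the iterates -/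

/-- Integrating the intensity over `(0, t]`: the points of `(0, t]` contribute at most the
`L¹` norm of `h⁺` each. -/
lemma lintegral_intensity_le {lam : ℝ} {h : ℝ → ℝ} (hh : Measurable h) (ν : Measure ℝ) [SFinite ν]
    (t : ℝ) :
    ∫⁻ u in Ioc 0 t, intensity lam h ν u ≤ ENNReal.ofReal lam * ENNReal.ofReal t
      + (∫⁻ u in Ioc 0 t, (∫⁻ s in Iic (0 : ℝ), ENNReal.ofReal (h (u - s)) ∂ν))
      + (∫⁻ v in Ioi (0 : ℝ), ENNReal.ofReal (h v)) * ν (Ioc 0 t) := by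
  have hk : Measurable fun p : ℝ × ℝ ↦ ENNReal.ofReal (h (p.1 - p.2)) := by fun_prop
  have hpast : Measurable fun u ↦ ∫⁻ s in Iic (0 : ℝ), ENNReal.ofReal (h (u - s)) ∂ν :=
    Measurable.lintegral_prod_right' (f := fun p : ℝ × ℝ ↦ ENNReal.ofReal (h (p.1 - p.2))) hk
  have hle : ∀ u ∈ Ioc 0 t, intensity lam h ν u ≤ (ENNReal.ofReal lam
      + ∫⁻ s in Iic (0 : ℝ), ENNReal.ofReal (h (u - s)) ∂ν)
      + ∫⁻ s in Ioc 0 t, {p : ℝ × ℝ | p.2 < p.1}.indicator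
        (fun p ↦ ENNReal.ofReal (h (p.1 - p.2))) (u, s) ∂ν := by
    intro u hu
    refine tsub_le_self.trans ?_
    rw [restrict_Iio_eq_add _ hu.1, lintegral_add_measure, ← add_assoc]
    refine add_le_add le_rfl ?_
    rw [← lintegral_indicator measurableSet_Ioo, ← lintegral_indicator measurableSet_Ioc]
    refine lintegral_mono fun s ↦ ?_
    by_cases hs : s ∈ Ioo 0 u
    · have hs' : s ∈ Ioc 0 t := ⟨hs.1, hs.2.le.trans hu.2⟩
      have : (u, s) ∈ {p : ℝ × ℝ | p.2 < p.1} := hs.2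
      rw [indicator_of_mem hs, indicator_of_mem hs', indicator_of_mem this]
    · rw [indicator_of_notMem hs]
      exact zero_le
  have hm : MeasurableSet {p : ℝ × ℝ | p.2 < p.1} := measurableSet_lt measurable_snd measurable_fst
  have hswap : ∫⁻ u in Ioc 0 t, (∫⁻ s in Ioc 0 t, {p : ℝ × ℝ | p.2 < p.1}.indicator
        (fun p ↦ ENNReal.ofReal (h (p.1 - p.2))) (u, s) ∂ν)
      ≤ (∫⁻ v in Ioi (0 : ℝ), ENNReal.ofReal (h v)) * ν (Ioc 0 t) := by
    rw [lintegral_lintegral_swap (f := fun u s ↦ {p : ℝ × ℝ | p.2 < p.1}.indicator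
      (fun p ↦ ENNReal.ofReal (h (p.1 - p.2))) (u, s)) (hk.indicator hm).aemeasurable,
      ← setLIntegral_const]
    refine lintegral_mono fun s ↦ (setLIntegral_le_lintegral _ _).trans (le_of_eq ?_)
    rw [← lintegral_indicator measurableSet_Ioi,
      ← lintegral_sub_right_eq_self (fun v ↦ (Ioi 0).indicator (fun v ↦ ENNReal.ofReal (h v)) v) s]
    refine lintegral_congr fun u ↦ ?_
    simp [indicator]
  calc ∫⁻ u in Ioc 0 t, intensity lam h ν u
      ≤ ∫⁻ u in Ioc 0 t, ((ENNReal.ofReal lam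
          + ∫⁻ s in Iic (0 : ℝ), ENNReal.ofReal (h (u - s)) ∂ν)
        + ∫⁻ s in Ioc 0 t, {p : ℝ × ℝ | p.2 < p.1}.indicator
          (fun p ↦ ENNReal.ofReal (h (p.1 - p.2))) (u, s) ∂ν) :=
        setLIntegral_mono' measurableSet_Ioc hle
    _ ≤ _ := by
        rw [lintegral_add_left (hpast.const_add _), lintegral_add_left measurable_const,
          setLIntegral_const, Real.volume_Ioc, sub_zero]
        gcongr

/-- The expected numbers of points of the iterates in `(0, t]` are bounded, since they satisfy
`x (n + 1) ≤ c + ‖h⁺‖₁ * x n`. -/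
lemma exists_lintegral_picard_le (hQ : IsPoissonPointProcess 𝓕 P Q)
    (hN0 : IsInitialCondition 𝓕 N0) (lam : ℝ) {h : ℝ → ℝ} (hh : Measurable h)
    (hnorm : ∫⁻ t in Ioi (0 : ℝ), ENNReal.ofReal (h t) < 1) {t : ℝ≥0}
    (hinit : ∫⁻ u in Ioc 0 (t : ℝ),
      (∫⁻ ω, (∫⁻ s in Iic (0 : ℝ), ENNReal.ofReal (h (u - s)) ∂(N0 ω)) ∂P) < ∞) :
    ∃ K < ∞, ∀ n, ∫⁻ ω, picard lam h (N0 ω) (Q ω) n (Ioc 0 (t : ℝ)) ∂P ≤ K := by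
  have hd := hQ.isDriven hN0
  set a := ∫⁻ t in Ioi (0 : ℝ), ENNReal.ofReal (h t) with ha
  set c := ENNReal.ofReal lam * ENNReal.ofReal (t : ℝ) + ∫⁻ u in Ioc 0 (t : ℝ),
      (∫⁻ ω, (∫⁻ s in Iic (0 : ℝ), ENNReal.ofReal (h (u - s)) ∂(N0 ω)) ∂P) with hc
  have hc' : c < ∞ := by
    rw [hc]
    exact ENNReal.add_lt_top.2 ⟨by finiteness, hinit⟩
  have ha0 : 1 - a ≠ 0 := (tsub_pos_of_lt hnorm).ne'
  have ha1 : 1 - a ≠ ∞ := (tsub_le_self.trans_lt ENNReal.one_lt_top).ne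
  have hstep : ∀ n, ∫⁻ ω, picard lam h (N0 ω) (Q ω) (n + 1) (Ioc 0 (t : ℝ)) ∂P
      ≤ c + a * ∫⁻ ω, picard lam h (N0 ω) (Q ω) n (Ioc 0 (t : ℝ)) ∂P := by
    intro n
    have hN := hd.isAdaptedPointProcess_picard lam hh n
    have hN0' : ∀ ω, N0 ω (Ioc 0 (t : ℝ)) = 0 := fun ω ↦
      measure_mono_null Ioc_subset_Ioi_self (hN0.support ω)
    have hΛ : Measurable[𝓕.predictable] fun p : ℝ≥0 × Ω ↦
        min (intensity lam h (picard lam h (N0 p.2) (Q p.2) n) (p.1 : ℝ)) n := by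
      let : MeasurableSpace (ℝ≥0 × Ω) := 𝓕.predictable
      exact (hN.measurable_intensity lam hh).min measurable_const
    have hsf : ∀ ω, SFinite (picard lam h (N0 ω) (Q ω) n) := fun ω ↦ (hN.counting ω).sFinite
    have hthin := hQ.lintegral_thinning_Ioc
      (Λ := fun ω u ↦ min (intensity lam h (picard lam h (N0 ω) (Q ω) n) u) n) hΛ
      (fun ω ↦ (measurable_intensity hh).min measurable_const) t
    have hNm : Measurable fun ω ↦ picard lam h (N0 ω) (Q ω) n (Ioc 0 (t : ℝ)) :=
      (hd.measurable_picard_Ioc lam hh n t).mono (𝓕.le t) le_rfl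
    have hN0m : Measurable fun x : Ω × ℝ ↦
        ∫⁻ s in Iic (0 : ℝ), ENNReal.ofReal (h (x.2 - s)) ∂(N0 x.1) :=
      measurable_lintegral_section
        (κ := fun x : Ω × ℝ ↦ (N0 x.1).restrict (Iic 0))
        ((measurable_measure_restrict measurableSet_Iic).comp
          ((hN0.measurable.mono (𝓕.le 0) le_rfl).comp measurable_fst))
        (fun x B hB ↦ (Measure.restrict_apply_le _ _).trans_lt
          ((hN0.counting x.1).finite_of_isBounded B hB))
        (f := fun y : (Ω × ℝ) × ℝ ↦ ENNReal.ofReal (h (y.1.2 - y.2))) (by fun_prop)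
    calc ∫⁻ ω, picard lam h (N0 ω) (Q ω) (n + 1) (Ioc 0 (t : ℝ)) ∂P
        = ∫⁻ ω, ∫⁻ u in Ioc 0 (t : ℝ),
            min (intensity lam h (picard lam h (N0 ω) (Q ω) n) u) n ∂volume ∂P := by
          simp only [picard, Measure.add_apply, hN0', zero_add]
          exact hthin
      _ ≤ ∫⁻ ω, ((ENNReal.ofReal lam * ENNReal.ofReal (t : ℝ)
            + ∫⁻ u in Ioc 0 (t : ℝ), (∫⁻ s in Iic (0 : ℝ), ENNReal.ofReal (h (u - s)) ∂(N0 ω)))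
            + a * picard lam h (N0 ω) (Q ω) n (Ioc 0 (t : ℝ))) ∂P := by
          refine lintegral_mono fun ω ↦ ?_
          refine (lintegral_mono fun u ↦ min_le_left _ _).trans
            ((lintegral_intensity_le hh _ t).trans (le_of_eq ?_))
          simp only [picard_restrict_Iic_zero, ha]
      _ = c + a * ∫⁻ ω, picard lam h (N0 ω) (Q ω) n (Ioc 0 (t : ℝ)) ∂P := by
          rw [lintegral_add_right _ (hNm.const_mul a), lintegral_add_left measurable_const,
            lintegral_const_mul _ hNm, lintegral_const, measure_univ, mul_one, hc,
            lintegral_lintegral_swap hN0m.aemeasurable]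
  refine ⟨c * (1 - a)⁻¹, ENNReal.mul_lt_top hc' (by simpa using ha0.bot_lt), fun n ↦ ?_⟩
  induction n with
  | zero =>
    have : ∀ ω, N0 ω (Ioc 0 (t : ℝ)) = 0 := fun ω ↦
      measure_mono_null Ioc_subset_Ioi_self (hN0.support ω)
    simp [picard, this]
  | succ n ih =>
    calc _ ≤ c + a * (c * (1 - a)⁻¹) := (hstep n).trans (by gcongr)
      _ = c * (((1 - a) + a) * (1 - a)⁻¹) := by
        rw [add_mul (1 - a) a, ENNReal.mul_inv_cancel ha0 ha1, mul_add c 1, mul_one, mul_left_comm]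
      _ = c * (1 - a)⁻¹ := by rw [tsub_add_cancel_of_le hnorm.le, one_mul]

end Expectation

/-! ### Existence of strong solutions and their conditional intensity -/

section Solution

variable {Ω : Type*} {mΩ : MeasurableSpace Ω} {P : Measure Ω}
  {𝓕 : Filtration ℝ≥0 mΩ} {Q : Ω → Measure (ℝ × ℝ)} {N0 : Ω → Measure ℝ} {lam : ℝ}

/-- If the Picard iterates for `f` are eventually constant on `(-∞, t]` wherever those for `h⁺` have
bounded masses on `(0, t]`, and the latter holds almost surely for all `t`, then the limit is a
strong solution of the equation for `f`. -/
lemma exists_isStrongSolution (hF : UsualConditions 𝓕 P) (hd : IsDriven 𝓕 N0 Q) {h f : ℝ → ℝ}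
    (hh : Measurable h) (hf : Measurable f)
    (hstab : ∀ ω, ∀ t : ℝ≥0,
      ⨆ n, picard lam (fun t ↦ max (h t) 0) (N0 ω) (Q ω) n (Ioc 0 (t : ℝ)) < ∞ →
        Stabilizes (picard lam f (N0 ω) (Q ω)) t)
    (hfin : ∀ᵐ ω ∂P, ∀ t : ℝ≥0,
      ⨆ n, picard lam (fun t ↦ max (h t) 0) (N0 ω) (Q ω) n (Ioc 0 (t : ℝ)) < ∞) :
    ∃ N : Ω → Measure ℝ, IsStrongSolution 𝓕 P lam f N0 Q N ∧
      ∀ᵐ ω ∂P, IsLimit (picard lam f (N0 ω) (Q ω)) (N ω) := by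
  classical
  set G : Set Ω := {ω | ∀ t : ℝ≥0,
    ⨆ n, picard lam (fun t ↦ max (h t) 0) (N0 ω) (Q ω) n (Ioc 0 (t : ℝ)) < ∞} with hG
  have hGm : ∀ t, MeasurableSet[𝓕 t] G := fun t ↦
    𝓕.mono zero_le G (@MeasurableSet.of_compl _ _ (𝓕 0) (hF.null_mem _ hfin))
  choose! L hL using fun ω (hω : ω ∈ G) ↦ exists_isLimit fun t ↦ hstab ω t (hω t)
  -- off the event `G`, which has a null complement in `𝓕 0`, any counting measure will do
  set N : Ω → Measure ℝ := G.piecewise L N0 with hN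
  have hNL : ∀ ω ∈ G, IsLimit (picard lam f (N0 ω) (Q ω)) (N ω) := fun ω hω ↦ by
    rw [hN, piecewise_eq_of_mem _ _ _ hω]
    exact hL ω hω
  have hNL' : ∀ᵐ ω ∂P, IsLimit (picard lam f (N0 ω) (Q ω)) (N ω) := by
    filter_upwards [hfin] with ω hω using hNL ω hω
  refine ⟨N, ⟨⟨⟨fun ω ↦ ?_, fun t ↦ ?_⟩, ?_⟩, fun t ↦ ?_⟩, hNL'⟩
  · by_cases hω : ω ∈ G
    · exact (hNL ω hω).isCountingMeasure
        (isCountingMeasure_picard hf (hd.counting_initial ω) (hd.counting ω))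
    · rw [hN, piecewise_eq_of_notMem _ _ _ hω]
      exact hd.counting_initial ω
  · obtain ⟨M, hM, hMG⟩ := @exists_measurable_eventually_eq Ω (𝓕 t)
      (fun n ω ↦ (picard lam f (N0 ω) (Q ω) n).restrict (Iic (t : ℝ)))
      (fun n ↦ (hd.isAdaptedPointProcess_picard lam hf n).adapted t) G (hGm t)
      fun ω hω ↦ ⟨_, hNL ω hω t⟩
    have hinit : Measurable[𝓕 t] fun ω ↦ (N0 ω).restrict (Iic (t : ℝ)) :=
      (measurable_measure_restrict measurableSet_Iic).comp
        (hd.measurable_initial.mono (𝓕.mono zero_le) le_rfl)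
    have : (fun ω ↦ (N ω).restrict (Iic (t : ℝ)))
        = G.piecewise M fun ω ↦ (N0 ω).restrict (Iic (t : ℝ)) := by
      ext1 ω
      by_cases hω : ω ∈ G
      · rw [piecewise_eq_of_mem _ _ _ hω]
        obtain ⟨n, hn, hn'⟩ := ((hMG ω hω).and (hNL ω hω t)).exists
        exact hn'.symm.trans hn
      · rw [piecewise_eq_of_notMem _ _ _ hω, hN, piecewise_eq_of_notMem _ _ _ hω]
    rw [this]
    let : MeasurableSpace Ω := 𝓕 t
    exact Measurable.piecewise (hGm t) hM hinit
  · filter_upwards [hNL'] with ω hω using hω.equation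
  · -- the same limit, along the filtration generated by the data
    have hd' := hd.drivingFiltration
    have hAm : MeasurableSet[drivingSigma N0 Q t] {ω |
        ⨆ n, picard lam (fun t ↦ max (h t) 0) (N0 ω) (Q ω) n (Ioc 0 (t : ℝ)) < ∞} := by
      have hm : ∀ n, Measurable[drivingSigma N0 Q t]
          fun ω ↦ picard lam (fun t ↦ max (h t) 0) (N0 ω) (Q ω) n (Ioc 0 (t : ℝ)) := fun n ↦
        hd'.measurable_picard_Ioc lam (hh.max measurable_const) n t
      let : MeasurableSpace Ω := drivingSigma N0 Q t
      exact measurableSet_lt (Measurable.iSup hm) measurable_const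
    obtain ⟨M, hM, hMG⟩ := @exists_measurable_eventually_eq Ω (drivingSigma N0 Q t)
      (fun n ω ↦ (picard lam f (N0 ω) (Q ω) n).restrict (Iic (t : ℝ)))
      (fun n ↦ (hd'.isAdaptedPointProcess_picard lam hf n).adapted t) _ hAm
      fun ω hω ↦ by
        obtain ⟨n₁, hn₁⟩ := hstab ω t hω
        exact ⟨_, eventually_atTop.2 ⟨n₁, hn₁⟩⟩
    refine ⟨M, hM, ?_⟩
    filter_upwards [hfin, hNL'] with ω hω hω'
    obtain ⟨n, hn, hn'⟩ := ((hMG ω (hω t)).and (hω' t)).exists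
    exact hn'.symm.trans hn

/-- A solution is determined by the data up to a null set, path by path. -/
lemma IsStrongSolution.isPathwiseUnique {f : ℝ → ℝ} {N : Ω → Measure ℝ}
    (hN : IsStrongSolution 𝓕 P lam f N0 Q N) :
    IsPathwiseUniqueStrongSolution 𝓕 P lam f N0 Q N :=
  ⟨hN, fun N' hN' ↦ by
    filter_upwards [hN.solution.equation, hN'.equation] with ω h1 h2
    exact eq_of_equation (hN'.adapted.counting ω) (hN.solution.adapted.counting ω) h2 h1⟩

variable [IsProbabilityMeasure P]

/-- A solution with locally finite mean measure is a Hawkes process. -/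
lemma IsSolution.isHawkesProcess (hQ : IsPoissonPointProcess 𝓕 P Q)
    (hN0 : IsInitialCondition 𝓕 N0) {f : ℝ → ℝ} (hf : Measurable f) {N : Ω → Measure ℝ}
    (hN : IsSolution 𝓕 P lam f N0 Q N) (hfin : ∀ t : ℝ≥0, ∫⁻ ω, N ω (Ioc 0 (t : ℝ)) ∂P < ∞) :
    IsHawkesProcess 𝓕 P lam f N0 N := by
  have hpred := hN.adapted.measurable_intensity lam hf
  have hmeas : ∀ ω, Measurable (intensity lam f (N ω)) := fun ω ↦ by
    have := (hN.adapted.counting ω).sFinite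
    exact measurable_intensity hf
  have hN0' : ∀ ω, (N0 ω).restrict (Ioi 0) = 0 := fun ω ↦
    Measure.restrict_eq_zero.2 (hN0.support ω)
  have hcomp : ∀ C : ℝ≥0 × Ω → ℝ≥0∞, Measurable[𝓕.predictable] C →
      ∫⁻ ω, (∫⁻ u in Ioi (0 : ℝ), C (u.toNNReal, ω) ∂(N ω)) ∂P
        = ∫⁻ ω, (∫⁻ u in Ioi (0 : ℝ), C (u.toNNReal, ω) * intensity lam f (N ω) u ∂volume) ∂P := by
    intro C hC
    rw [← hQ.lintegral_thinning (Λ := fun ω ↦ intensity lam f (N ω)) hpred hmeas hC]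
    refine lintegral_congr_ae ?_
    filter_upwards [hN.equation] with ω hω
    have : (N ω).restrict (Ioi 0) = (thinning (Q ω) (intensity lam f (N ω))).restrict (Ioi 0) := by
      conv_lhs => rw [hω]
      rw [Measure.restrict_add, hN0' ω, zero_add]
    rw [this]
  refine ⟨hN.adapted, ?_, hpred, ?_, hcomp⟩
  · filter_upwards [hN.equation] with ω hω
    rw [hω, Measure.restrict_add, thinning_restrict_Iic_zero, add_zero]
    refine Measure.restrict_eq_self_of_ae_mem ?_
    rw [ae_iff]
    convert hN0.support ω using 2
    ext x
    simp
  · have hk : ∀ k : ℕ, ∀ᵐ ω ∂P, ∫⁻ u in Ioc (0 : ℝ) k, intensity lam f (N ω) u < ∞ := by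
      intro k
      have hE := hcomp _ (measurable_predictable_indicator_Ioc 𝓕 k)
      simp only [setLIntegral_Ioi_indicator_Ioc] at hE
      refine ae_lt_top ?_ ?_
      · have hjoint : Measurable fun p : Ω × ℝ ↦ intensity lam f (N p.1) (p.2.toNNReal : ℝ) :=
          (hpred.mono (predictable_le_prod 𝓕) le_rfl).comp
            (f := fun p : Ω × ℝ ↦ (p.2.toNNReal, p.1)) (by fun_prop)
        convert hjoint.lintegral_prod_right' (ν := volume.restrict (Ioc (0 : ℝ) k)) using 2 with ω
        refine setLIntegral_congr_fun measurableSet_Ioc fun u hu ↦ ?_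
        simp only [Real.coe_toNNReal _ hu.1.le]
      · rw [← hE]
        refine ne_of_eq_of_ne (lintegral_congr fun ω ↦ ?_) (hfin k).ne
        have := setLIntegral_Ioi_indicator_Ioc (N ω) 1 ω (k : ℝ)
        simpa using this
    filter_upwards [ae_all_iff.2 hk] with ω hω t
    obtain ⟨k, hk⟩ := exists_nat_ge t
    exact (lintegral_mono_set (Ioc_subset_Ioc_right hk)).trans_lt (hω k)

end Solution

end SignedHawkes

theorem proposition2p1 {Ω : Type*} {mΩ : MeasurableSpace Ω}
    (P : Measure Ω) [IsProbabilityMeasure P]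
    (𝓕 : Filtration ℝ≥0 mΩ) (hF : SignedHawkes.UsualConditions 𝓕 P)
    (Q : Ω → Measure (ℝ × ℝ)) (hQ : SignedHawkes.IsPoissonPointProcess 𝓕 P Q)
    (lam : ℝ) (hlam : 0 < lam)
    (h : ℝ → ℝ) (hh : Measurable h)
    (N0 : Ω → Measure ℝ) (hN0 : SignedHawkes.IsInitialCondition 𝓕 N0)
    (hnorm : ∫⁻ t in Ioi (0 : ℝ), ENNReal.ofReal (h t) < 1)
    (hinit : ∀ t : ℝ, 0 < t →
      ∫⁻ u in Ioc 0 t, (∫⁻ ω, (∫⁻ s in Iic (0 : ℝ), ENNReal.ofReal (h (u - s)) ∂(N0 ω)) ∂P) < ∞) :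
    ∃ N Np : Ω → Measure ℝ,
      (SignedHawkes.IsPathwiseUniqueStrongSolution 𝓕 P lam h N0 Q N ∧
        SignedHawkes.IsHawkesProcess 𝓕 P lam h N0 N) ∧
      (SignedHawkes.IsPathwiseUniqueStrongSolution 𝓕 P lam (fun t ↦ max (h t) 0) N0 Q Np ∧
        SignedHawkes.IsHawkesProcess 𝓕 P lam (fun t ↦ max (h t) 0) N0 Np) ∧
      ∀ᵐ ω ∂P, N ω ≤ Np ω := by
  have hd := hQ.isDriven hN0
  have hhp : Measurable fun t ↦ max (h t) 0 := hh.max measurable_const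
  have hmean : ∀ t : ℝ≥0, ∫⁻ ω, ⨆ n, SignedHawkes.picard lam (fun t ↦ max (h t) 0) (N0 ω) (Q ω) n
      (Ioc 0 (t : ℝ)) ∂P < ∞ := by
    intro t
    rcases eq_zero_or_pos t with rfl | ht
    · simp
    obtain ⟨K, hK, hle⟩ := SignedHawkes.exists_lintegral_picard_le hQ hN0 lam hhp
      (by simpa using hnorm) (t := t) (by simpa using hinit t ht)
    rw [lintegral_iSup]
    · exact (iSup_le hle).trans_lt hK
    · intro n
      exact hd.measurable_picard_Ioc lam hhp n t |>.mono (𝓕.le _) le_rfl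
    · exact fun m n hmn ω ↦ SignedHawkes.picard_max_mono hmn _
  have hfin : ∀ᵐ ω ∂P, ∀ t : ℝ≥0,
      ⨆ n, SignedHawkes.picard lam (fun t ↦ max (h t) 0) (N0 ω) (Q ω) n (Ioc 0 (t : ℝ)) < ∞ := by
    have : ∀ k : ℕ, ∀ᵐ ω ∂P, ⨆ n,
        SignedHawkes.picard lam (fun t ↦ max (h t) 0) (N0 ω) (Q ω) n (Ioc 0 (k : ℝ)) < ∞ :=
      fun k ↦ ae_lt_top (Measurable.iSup fun n ↦
        (hd.measurable_picard_Ioc lam hhp n k).mono (𝓕.le _) le_rfl) (hmean k).ne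
    filter_upwards [ae_all_iff.2 this] with ω hω t
    obtain ⟨k, hk⟩ := exists_nat_ge (t : ℝ)
    exact (iSup_mono fun n ↦ measure_mono (Ioc_subset_Ioc_right hk)).trans_lt (hω k)
  obtain ⟨N, hN, hNlim⟩ := SignedHawkes.exists_isStrongSolution hF hd hh hh
    (fun ω t ht ↦ SignedHawkes.stabilizes_picard hh (hd.counting_initial ω) (hd.counting ω) t.2 ht)
    hfin
  obtain ⟨Np, hNp, hNplim⟩ := SignedHawkes.exists_isStrongSolution hF hd hh hhp
    (fun ω t ht ↦ SignedHawkes.stabilizes_picard_max hh (hd.counting_initial ω) (hd.counting ω)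
      t.2 ht) hfin
  have hle : ∀ᵐ ω ∂P, N ω ≤ Np ω := by
    filter_upwards [hNlim, hNplim] with ω h1 h2
    exact h1.mono h2 SignedHawkes.picard_le_picard_max
  have hNpm : ∀ t : ℝ≥0, ∫⁻ ω, Np ω (Ioc 0 (t : ℝ)) ∂P < ∞ := fun t ↦
    (lintegral_mono_ae (hNplim.mono fun ω hω ↦ hω.le_iSup t)).trans_lt (hmean t)
  have hNm : ∀ t : ℝ≥0, ∫⁻ ω, N ω (Ioc 0 (t : ℝ)) ∂P < ∞ := fun t ↦
    (lintegral_mono_ae (hle.mono fun ω hω ↦ hω _)).trans_lt (hNpm t)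
  exact ⟨N, Np, ⟨hN.isPathwiseUnique, hN.solution.isHawkesProcess hQ hN0 hh hNm⟩,
    ⟨hNp.isPathwiseUnique, hNp.solution.isHawkesProcess hQ hN0 hhp hNpm⟩, hle⟩
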